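/- **Setting.** Let $H_1\in\mathbb F_2^{K_1\times B_1}$, $H_2\in\mathbb F_2^{K_2\times B_2}$ (finite index sets) be parity-check matrices of classical codes $C_1,C_2$, and let $T_i$ be the Tanner graph of $C_i$: vertex set $K_i\sqcup B_i$, one edge for each nonzero entry of $H_i$. Assume that $T_1$ and $T_2$ are connected, and fix base vertices $t_i\in T_i$. The hypergraph-product code $C=C_1\otimes C_2^*$ has $X=K_1\times B_2$, $Q=(B_1\times B_2)\sqcup(K_1\times K_2)$, $Z=B_1\times K_2$ and $$H_X=[H_1\otimes 1\mid 1\otimes H_2^T],\qquad H_Z=[1\otimes H_2\mid H_1^T\otimes 1].$$ Fix its $\mathbb Z$-lift $\tilde H_X=[H_1\otimes 1\mid 1\otimes H_2^T]$, $\tilde H_Z=[1\otimes H_2\mid -H_1^T\otimes 1]$, with entries $0,1$ of $H_1,H_2$ read in $\mathbb Z$. **Cellular realizations.** Let $\tilde T$ be the graph with vertex set $X\sqcup Q$ and $|(\tilde H_X)_{x,q}|$ edges between $q$ and $x$, signed by $(\tilde H_X)_{x,q}$. For $z\in Z$ let $\tilde T_z\subset\tilde T$ be the subgraph consisting of the qubits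 in the support of $z$, the checks $x$ having one of these qubits in their support, and all edges between them. Let $G_z$ be obtained by taking $|(\tilde H_Z)_{z,q}|$ copies of each qubit $q$ with its edges, multiplying signs by that of $(\tilde H_Z)_{z,q}$, pairing at each $x$ edges of opposite sign, and gluing each pair to a separate copy of $x$. A cellular realization $L\in\mathcal L(C)$ of $C$ is a cell complex, described combinatorially, obtained from $\tilde T$ by choosing, for each $z$: such a pairing; $1$-cells joining the components of $G_z$ in a tree-like way (one fewer than the number of components), attached to $\tilde T_z$ through the projection $G_z\to\tilde T_z$; and finitely many $2$-cells attached along closed edge paths in the union of $\tilde T_z$ and these $1$-cells, such that the resulting complex $A_z$ is simply connected. Finally there are one $3$-cell per $x\in X$ at the vertex $x$, one $4$-cell per $q\in Q$ attached along the edges at $q$ to the $3$-cells with degrees $(\tilde H_X)_{x,q}$, and one $5$-cell per $z\in Z$ attached along $A_z$ to the $4$-cells with degrees $(\tilde H_Z)_{z,q}$. Fundamental groups and coverings are those of the combinatorial complexes (edge-path groups and locally bijective cellular maps; cells of dimension at least $3$ lift uniquely). **Cellular lifts.** A covering $p:L'\to L$ determines the matrices $H_X',H_Z'$ over $\mathbb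 F_2$ of $\mathcal C_5(L';\mathbb F_2)\to\mathcal C_4(L';\mathbb F_2)\to\mathcal C_3(L';\mathbb F_2)$: the $X$-checks and qubits are the vertices of $L'$ over $X$ and over $Q$, the $Z$-checks are the connected components of the sets $p^{-1}(A_z)$, $(H'_X)_{x',q'}$ is the number mod $2$ of lifts of edges of $\tilde T$ joining $q'$ to $x'$, and $(H_Z')_{z',q'}=(H_Z)_{z,q}$ if $q'$ lies in the component $z'$ and $0$ otherwise. If $p$ is finite, the resulting code $C'$ is the cellular lift of $C$ associated to $p$. Coverings are taken connected, with a base point over a vertex $v\in X\sqcup Q$ of $L$. **Theorem.** $\mathcal L(C)$ is nonempty, and the cellular lifts of $C$ are classified by the subgroups of $\pi_1(T_1,t_1)\times\pi_1(T_2,t_2)$. Precisely, there are isomorphisms $\Phi_{L,v}:\pi_1(L,v)\to\pi_1(T_1,t_1)\times\pi_1(T_2,t_2)$, one for every $L\in\mathcal L(C)$ and every vertex $v\in X\sqcup Q$, such that, writing $H(p)=\Phi_{L,v}(p_*\pi_1(L',v'))$ for a connected covering $p:(L',v')\to(L,v)$: 1. for all $L$ and $v$, every subgroup of $\pi_1(T_1,t_1)\times\pi_1(T_2,t_2)$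 is $H(p)$ for some connected covering $p:(L',v')\to(L,v)$; 2. two connected pointed coverings $p_1,p_2$ of $(L,v)$ are isomorphic if and only if $H(p_1)=H(p_2)$; 3. the number of vertices of $L'$ over any vertex of $L$ is the index of $H(p)$; in particular $L'$ is finite if and only if $H(p)$ has finite index, and then $H_X'(H_Z')^T=0$, so that $C'$ is a CSS code; 4. for any $L_1,L_2\in\mathcal L(C)$, any $v$, and connected coverings $p_i:(L_i',v_i')\to(L_i,v)$, the subgroups $H(p_1)$ and $H(p_2)$ are equal if and only if there are bijections between the $X$-checks, qubits and $Z$-checks of the two lifts which are compatible with the projections to those of $C$ and with the base points and which carry the parity-check matrices of one lift to those of the other. In particular the set of cellular lifts does not depend on the realization $L$. -/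

import Mathlib

open scoped Kronecker Matrix

universe u

/-! ### Combinatorial graphs and two-dimensional complexes -/

/-- A multigraph (loops and parallel edges allowed); every edge carries a reference orientation. -/
structure MultiGraph where
  V : Type u
  E : Type u
  src : E → V
  tgt : E → V

namespace MultiGraph

variable (G : MultiGraph.{u})

/-- An oriented edge: `(e, true)` is `e` with its reference orientation, `(e, false)` is the
reversed edge. -/
abbrev Dart : Type u := G.E × Bool

def dsrc (d : G.Dart) : G.V := if d.2 then G.src d.1 else G.tgt d.1

def dtgt (d : G.Dart) : G.V := if d.2 then G.tgt d.1 else G.src d.1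

def flip (d : G.Dart) : G.Dart := (d.1, !d.2)

/-- The list of oriented edges `l` is an edge path from `a` to `b`. -/
def IsWalk : G.V → G.V → List G.Dart → Prop
  | a, b, [] => a = b
  | a, b, d :: l => G.dsrc d = a ∧ IsWalk (G.dtgt d) b l

/-- The reversed edge path. -/
def revWalk (l : List G.Dart) : List G.Dart := (l.map G.flip).reverse

/-- Any two vertices are joined by an edge path (the empty graph is allowed). -/
def Preconnected : Prop := ∀ a b : G.V, ∃ l, G.IsWalk a b l

/-- Nonempty, and any two vertices are joined by an edge path. -/
def Connected : Prop := Nonempty G.V ∧ G.Preconnected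

variable {G}

theorem IsWalk.append {a b c : G.V} {l m : List G.Dart} (hl : G.IsWalk a b l)
    (hm : G.IsWalk b c m) : G.IsWalk a c (l ++ m) := by
  induction l generalizing a with
  | nil => cases hl; exact hm
  | cons d l ih => exact ⟨hl.1, ih hl.2⟩

theorem IsWalk.split {a c : G.V} {l m : List G.Dart} (h : G.IsWalk a c (l ++ m)) :
    ∃ b, G.IsWalk a b l ∧ G.IsWalk b c m := by
  induction l generalizing a with
  | nil => exact ⟨a, rfl, h⟩
  | cons d l ih =>
    obtain ⟨b, h1, h2⟩ := ih h.2
    exact ⟨b, ⟨h.1, h1⟩, h2⟩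

theorem dsrc_flip (d : G.Dart) : G.dsrc (G.flip d) = G.dtgt d := by
  rcases d with ⟨e, _ | _⟩ <;> simp [dsrc, dtgt, flip]

theorem dtgt_flip (d : G.Dart) : G.dtgt (G.flip d) = G.dsrc d := by
  rcases d with ⟨e, _ | _⟩ <;> simp [dsrc, dtgt, flip]

theorem flip_flip (d : G.Dart) : G.flip (G.flip d) = d := by
  rcases d with ⟨e, _ | _⟩ <;> rfl

theorem revWalk_cons (d : G.Dart) (l : List G.Dart) :
    G.revWalk (d :: l) = G.revWalk l ++ [G.flip d] := by simp [revWalk]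

theorem revWalk_append (l m : List G.Dart) :
    G.revWalk (l ++ m) = G.revWalk m ++ G.revWalk l := by simp [revWalk]

theorem revWalk_revWalk (l : List G.Dart) : G.revWalk (G.revWalk l) = l := by
  induction l with
  | nil => rfl
  | cons d l ih => rw [revWalk_cons, revWalk_append, ih]; simp [revWalk, flip_flip]

theorem IsWalk.rev {a b : G.V} {l : List G.Dart} (h : G.IsWalk a b l) :
    G.IsWalk b a (G.revWalk l) := by
  induction l generalizing a with
  | nil => exact h.symm
  | cons d l ih =>
    rw [revWalk_cons]
    exact (ih h.2).append ⟨dsrc_flip d, (dtgt_flip d).trans h.1⟩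

end MultiGraph

/-- A combinatorial two-dimensional cell complex: a multigraph (the 1-skeleton) with 2-cells, each
attached along a closed edge path starting at a marked vertex. -/
structure TwoComplex extends MultiGraph.{u} where
  F : Type u
  base : F → V
  bdry : F → List (E × Bool)
  bdry_closed : ∀ f, toMultiGraph.IsWalk (base f) (base f) (bdry f)

namespace TwoComplex

variable (L : TwoComplex.{u})

/-- Edge paths from `a` to `b`. -/
def Walk (a b : L.V) : Type u := {l : List L.Dart // L.IsWalk a b l}

/-- Elementary homotopies: insert a backtrack, or the boundary of a 2-cell. -/
inductive Elem : List L.Dart → List L.Dart → Prop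
  | cancel (l m : List L.Dart) (d : L.Dart) : Elem (l ++ m) (l ++ ([d, L.flip d] ++ m))
  | face (l m : List L.Dart) (f : L.F) : Elem (l ++ m) (l ++ (L.bdry f ++ m))

/-- Homotopy of edge paths with fixed end points: the equivalence relation generated by elementary
homotopies through edge paths from `a` to `b`. -/
def Homotopic {a b : L.V} : L.Walk a b → L.Walk a b → Prop :=
  Relation.EqvGen fun w w' => L.Elem w.1 w'.1

/-- Any two vertices are joined by an edge path and every closed edge path is null-homotopic
(the empty complex is allowed). -/
def SimplyConnected : Prop :=
  L.Preconnected ∧ ∀ (a : L.V) (w : L.Walk a a), L.Homotopic w ⟨[], rfl⟩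

variable {L}

def Walk.append {a b c : L.V} (w : L.Walk a b) (w' : L.Walk b c) : L.Walk a c :=
  ⟨w.1 ++ w'.1, w.2.append w'.2⟩

def Walk.rev {a b : L.V} (w : L.Walk a b) : L.Walk b a := ⟨L.revWalk w.1, w.2.rev⟩

theorem Elem.append_right {l m : List L.Dart} (h : L.Elem l m) (r : List L.Dart) :
    L.Elem (l ++ r) (m ++ r) := by
  cases h with
  | cancel l m d => simpa using Elem.cancel l (m ++ r) d
  | face l m f => simpa using Elem.face l (m ++ r) f

theorem Elem.append_left {l m : List L.Dart} (h : L.Elem l m) (r : List L.Dart) :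
    L.Elem (r ++ l) (r ++ m) := by
  cases h with
  | cancel l m d => simpa using Elem.cancel (r ++ l) m d
  | face l m f => simpa using Elem.face (r ++ l) m f

theorem Homotopic.refl {a b : L.V} (w : L.Walk a b) : L.Homotopic w w := Relation.EqvGen.refl w

theorem Homotopic.symm {a b : L.V} {w w' : L.Walk a b} (h : L.Homotopic w w') :
    L.Homotopic w' w := Relation.EqvGen.symm _ _ h

theorem Homotopic.trans {a b : L.V} {w w' w'' : L.Walk a b} (h : L.Homotopic w w')
    (h' : L.Homotopic w' w'') : L.Homotopic w w'' := Relation.EqvGen.trans _ _ _ h h'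

theorem Homotopic.append {a b c : L.V} {w w' : L.Walk a b} {x x' : L.Walk b c}
    (h : L.Homotopic w w') (h' : L.Homotopic x x') :
    L.Homotopic (w.append x) (w'.append x') := by
  have h1 : L.Homotopic (w.append x) (w'.append x) := by
    induction h with
    | rel _ _ h => exact .rel _ _ (h.append_right _)
    | refl _ => exact .refl _
    | symm _ _ _ ih => exact Relation.EqvGen.symm _ _ ih
    | trans _ _ _ _ _ ih ih' => exact Relation.EqvGen.trans _ _ _ ih ih'
  have h2 : L.Homotopic (w'.append x) (w'.append x') := by
    clear h1
    induction h' with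
    | rel _ _ h => exact .rel _ _ (h.append_left _)
    | refl _ => exact .refl _
    | symm _ _ _ ih => exact Relation.EqvGen.symm _ _ ih
    | trans _ _ _ _ _ ih ih' => exact Relation.EqvGen.trans _ _ _ ih ih'
  exact h1.trans h2

theorem Homotopic.append_rev {a b : L.V} (w : L.Walk a b) :
    L.Homotopic (w.append w.rev) ⟨[], rfl⟩ := by
  obtain ⟨l, hl⟩ := w
  induction l using List.reverseRecOn generalizing b with
  | nil => exact .refl _
  | append_singleton l d ih =>
    obtain ⟨c, h1, h2⟩ := hl.split
    refine Homotopic.trans (Homotopic.symm (.rel _ _ ?_)) (ih h1)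
    have := Elem.cancel (L := L) l (L.revWalk l) d
    simpa [Walk.append, Walk.rev, MultiGraph.revWalk_append, MultiGraph.revWalk] using this

theorem Homotopic.rev_append {a b : L.V} (w : L.Walk a b) :
    L.Homotopic (w.rev.append w) ⟨[], rfl⟩ := by
  have h := Homotopic.append_rev w.rev
  have e : w.rev.rev = w := Subtype.ext (MultiGraph.revWalk_revWalk _)
  rwa [e] at h

theorem Homotopic.rev {a b : L.V} {w w' : L.Walk a b} (h : L.Homotopic w w') :
    L.Homotopic w.rev w'.rev := by
  have e1 : L.Homotopic (w.rev.append (w'.append w'.rev)) w.rev := by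
    have := (Homotopic.refl w.rev).append (Homotopic.append_rev w')
    have e : w.rev.append (⟨[], rfl⟩ : L.Walk a a) = w.rev := Subtype.ext (List.append_nil _)
    rwa [e] at this
  have e2 : L.Homotopic (w.rev.append (w'.append w'.rev)) w'.rev := by
    have h3 : L.Homotopic (w.rev.append w') ⟨[], rfl⟩ :=
      ((Homotopic.refl _).append h.symm).trans (Homotopic.rev_append w)
    have := h3.append (Homotopic.refl w'.rev)
    have e : (w.rev.append w').append w'.rev = w.rev.append (w'.append w'.rev) :=
      Subtype.ext (List.append_assoc _ _ _)
    rw [e] at this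
    exact this
  exact e1.symm.trans e2

variable (L)

/-- Homotopy as a setoid on the closed edge paths at `v`. -/
def loopSetoid (v : L.V) : Setoid (L.Walk v v) where
  r := L.Homotopic
  iseqv := ⟨Homotopic.refl, Homotopic.symm, Homotopic.trans⟩

/-- The fundamental group (edge-path group) of a combinatorial complex at the vertex `v`: closed
edge paths at `v` up to homotopy, under concatenation. -/
def Pi1 (v : L.V) : Type u := Quotient (L.loopSetoid v)

instance (v : L.V) : Group (L.Pi1 v) where
  mul := Quotient.map₂ Walk.append fun _ _ h _ _ h' => Homotopic.append h h'
  one := Quotient.mk (L.loopSetoid v) ⟨[], rfl⟩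
  inv := Quotient.map Walk.rev fun _ _ h => Homotopic.rev h
  mul_assoc := by
    rintro ⟨a⟩ ⟨b⟩ ⟨c⟩
    exact congrArg (Quotient.mk _) (Subtype.ext (List.append_assoc _ _ _))
  one_mul := by
    rintro ⟨a⟩
    exact congrArg (Quotient.mk _) (Subtype.ext (List.nil_append _))
  mul_one := by
    rintro ⟨a⟩
    exact congrArg (Quotient.mk _) (Subtype.ext (List.append_nil _))
  inv_mul_cancel := by
    rintro ⟨a⟩
    exact Quotient.sound (Homotopic.rev_append a)

/-- Cellular maps sending vertices to vertices, edges to edges, 2-cells to 2-cells, compatibly with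
orientations, marked vertices and attaching paths. -/
structure Map (L' L : TwoComplex.{u}) where
  onV : L'.V → L.V
  onE : L'.E → L.E
  onF : L'.F → L.F
  src_onE : ∀ e, L.src (onE e) = onV (L'.src e)
  tgt_onE : ∀ e, L.tgt (onE e) = onV (L'.tgt e)
  base_onF : ∀ f, L.base (onF f) = onV (L'.base f)
  bdry_onF : ∀ f, L.bdry (onF f) = (L'.bdry f).map (Prod.map onE id)

namespace Map

variable {L' L : TwoComplex.{u}} (p : Map L' L)

def onDart (d : L'.Dart) : L.Dart := (p.onE d.1, d.2)

theorem dsrc_onDart (d : L'.Dart) : L.dsrc (p.onDart d) = p.onV (L'.dsrc d) := by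
  rcases d with ⟨e, _ | _⟩ <;> simp [MultiGraph.dsrc, onDart, p.src_onE, p.tgt_onE]

theorem dtgt_onDart (d : L'.Dart) : L.dtgt (p.onDart d) = p.onV (L'.dtgt d) := by
  rcases d with ⟨e, _ | _⟩ <;> simp [MultiGraph.dtgt, onDart, p.src_onE, p.tgt_onE]

theorem isWalk_map {a b : L'.V} {l : List L'.Dart} (h : L'.IsWalk a b l) :
    L.IsWalk (p.onV a) (p.onV b) (l.map p.onDart) := by
  induction l generalizing a with
  | nil => exact congrArg p.onV h
  | cons d l ih =>
    refine ⟨(p.dsrc_onDart d).trans (congrArg p.onV h.1), ?_⟩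
    rw [p.dtgt_onDart]
    exact ih h.2

def mapWalk {a b : L'.V} (w : L'.Walk a b) : L.Walk (p.onV a) (p.onV b) :=
  ⟨w.1.map p.onDart, p.isWalk_map w.2⟩

theorem elem_map {l m : List L'.Dart} (h : L'.Elem l m) :
    L.Elem (l.map p.onDart) (m.map p.onDart) := by
  cases h with
  | cancel l m d =>
    simpa [onDart, MultiGraph.flip] using
      Elem.cancel (L := L) (l.map p.onDart) (m.map p.onDart) (p.onDart d)
  | face l m f =>
    have := Elem.face (L := L) (l.map p.onDart) (m.map p.onDart) (p.onF f)
    rw [p.bdry_onF] at this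
    simp only [List.map_append]
    exact this

theorem homotopic_map {a b : L'.V} {w w' : L'.Walk a b} (h : L'.Homotopic w w') :
    L.Homotopic (p.mapWalk w) (p.mapWalk w') := by
  induction h with
  | rel _ _ h => exact .rel _ _ (p.elem_map h)
  | refl _ => exact .refl _
  | symm _ _ _ ih => exact Relation.EqvGen.symm _ _ ih
  | trans _ _ _ _ _ ih ih' => exact Relation.EqvGen.trans _ _ _ ih ih'

/-- The induced homomorphism of fundamental groups. -/
def onPi1 (v' : L'.V) : L'.Pi1 v' →* L.Pi1 (p.onV v') where
  toFun := Quotient.map p.mapWalk fun _ _ h => p.homotopic_map h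
  map_one' := rfl
  map_mul' := by
    rintro ⟨a⟩ ⟨b⟩
    exact congrArg (Quotient.mk _) (Subtype.ext List.map_append)

/-- Covering maps: locally bijective cellular maps. Every oriented edge starting at `p v'` has a
unique lift starting at `v'`, and every 2-cell with marked vertex `p v'` has a unique lift with
marked vertex `v'`. -/
def IsCovering : Prop :=
  (∀ (v' : L'.V) (d : L.Dart), L.dsrc d = p.onV v' → ∃! d' : L'.Dart,
    L'.dsrc d' = v' ∧ p.onDart d' = d) ∧
  (∀ (v' : L'.V) (f : L.F), L.base f = p.onV v' → ∃! f' : L'.F,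
    L'.base f' = v' ∧ p.onF f' = f)

end Map

/-- A connected covering of `L` with a chosen point over the vertex `v`. -/
structure PointedCover (L : TwoComplex.{u}) (v : L.V) where
  total : TwoComplex.{u}
  p : Map total L
  isCovering : p.IsCovering
  connected : total.Connected
  pt : total.V
  pt_over : p.onV pt = v

/-- The subgroup `p_* π₁(L', v')` of `π₁(L, v)`. -/
def PointedCover.subgroup {L : TwoComplex.{u}} {v : L.V} (c : L.PointedCover v) :
    Subgroup (L.Pi1 v) := c.pt_over ▸ (c.p.onPi1 c.pt).range

/-- Isomorphism of coverings of `L` preserving the chosen points. -/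
def PointedCover.Iso {L : TwoComplex.{u}} {v : L.V} (c d : L.PointedCover v) : Prop :=
  ∃ f : Map c.total d.total,
    (Function.Bijective f.onV ∧ Function.Bijective f.onE ∧ Function.Bijective f.onF) ∧
    (d.p.onV ∘ f.onV = c.p.onV ∧ d.p.onE ∘ f.onE = c.p.onE ∧ d.p.onF ∘ f.onF = c.p.onF) ∧
    f.onV c.pt = d.pt

end TwoComplex

/-! ### Codes and integral lifts -/

/-- A CSS code, given by its parity-check matrices (rows: checks, columns: qubits). -/
structure CSSCode (X Q Z : Type u) [Fintype Q] where
  HX : Matrix X Q (ZMod 2)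
  HZ : Matrix Z Q (ZMod 2)
  orth : HX * HZᵀ = 0

/-- A `ℤ`-lift of a CSS code. -/
structure ZLift {X Q Z : Type u} [Fintype Q] (C : CSSCode X Q Z) where
  hx : Matrix X Q ℤ
  hz : Matrix Z Q ℤ
  orth : hx * hzᵀ = 0
  hx_mod : hx.map (Int.cast : ℤ → ZMod 2) = C.HX
  hz_mod : hz.map (Int.cast : ℤ → ZMod 2) = C.HZ

/-- The Tanner graph of a classical code with parity-check matrix `H`: check vertices, bit
vertices, one edge for every nonzero entry; no 2-cells. -/
def tannerGraph {K B : Type u} (H : Matrix K B (ZMod 2)) : TwoComplex.{u} where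
  V := K ⊕ B
  E := {e : K × B // H e.1 e.2 ≠ 0}
  src e := Sum.inr e.1.2
  tgt e := Sum.inl e.1.1
  F := PEmpty
  base f := f.elim
  bdry f := f.elim
  bdry_closed f := f.elim

section HPC

variable {K₁ B₁ K₂ B₂ : Type u} [Fintype K₁] [Fintype B₁] [Fintype K₂] [Fintype B₂]
  [DecidableEq K₁] [DecidableEq B₁] [DecidableEq K₂] [DecidableEq B₂]

/-- Replace the entries `0, 1` of a binary matrix by the integers `0, 1`. -/
def naiveLift {m n : Type u} (M : Matrix m n (ZMod 2)) : Matrix m n ℤ :=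
  M.map fun a => (a.val : ℤ)

theorem naiveLift_mod {m n : Type u} (M : Matrix m n (ZMod 2)) :
    (naiveLift M).map (Int.cast : ℤ → ZMod 2) = M := by
  ext i j
  simp [naiveLift]

theorem hpc_orth {R : Type} [CommRing R] (M₁ : Matrix K₁ B₁ R) (M₂ : Matrix K₂ B₂ R) (s : R)
    (hs : 1 + s = 0) :
    Matrix.fromCols (M₁ ⊗ₖ (1 : Matrix B₂ B₂ R)) ((1 : Matrix K₁ K₁ R) ⊗ₖ M₂ᵀ) *
      (Matrix.fromCols ((1 : Matrix B₁ B₁ R) ⊗ₖ M₂)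
        (s • (M₁ᵀ ⊗ₖ (1 : Matrix K₂ K₂ R))))ᵀ = 0 := by
  rw [Matrix.transpose_fromCols, Matrix.fromCols_mul_fromRows]
  simp only [Matrix.transpose_smul, Matrix.mul_smul, ← Matrix.kroneckerMap_transpose,
    Matrix.transpose_transpose, Matrix.transpose_one, ← Matrix.mul_kronecker_mul, Matrix.mul_one,
    Matrix.one_mul]
  rw [← one_smul R (M₁ ⊗ₖ M₂ᵀ), smul_smul, ← add_smul, mul_one, hs, zero_smul]

/-- The hypergraph-product code `C₁ ⊗ C₂*`, with
`H_X = [H₁ ⊗ 1 | 1 ⊗ H₂ᵀ]` and `H_Z = [1 ⊗ H₂ | H₁ᵀ ⊗ 1]`. -/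
def hpc (H₁ : Matrix K₁ B₁ (ZMod 2)) (H₂ : Matrix K₂ B₂ (ZMod 2)) :
    CSSCode (K₁ × B₂) (B₁ × B₂ ⊕ K₁ × K₂) (B₁ × K₂) where
  HX := Matrix.fromCols (H₁ ⊗ₖ 1) (1 ⊗ₖ H₂ᵀ)
  HZ := Matrix.fromCols (1 ⊗ₖ H₂) (H₁ᵀ ⊗ₖ 1)
  orth := by
    have := hpc_orth H₁ H₂ 1 (by decide)
    rwa [one_smul] at this

theorem naiveLift_kronecker {l m n p : Type u} (M : Matrix l m (ZMod 2))
    (N : Matrix n p (ZMod 2)) : naiveLift (M ⊗ₖ N) = naiveLift M ⊗ₖ naiveLift N := by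
  ext i j
  simp only [naiveLift, Matrix.map_apply, Matrix.kroneckerMap_apply]
  generalize M i.1 j.1 = a
  generalize N i.2 j.2 = b
  revert a b
  decide

theorem naiveLift_one {n : Type u} [DecidableEq n] :
    naiveLift (1 : Matrix n n (ZMod 2)) = 1 := by
  ext i j
  by_cases h : i = j
  · subst h
    simp only [naiveLift, Matrix.map_apply, Matrix.one_apply_eq]
    decide
  · simp [naiveLift, h]

/-- The `ℤ`-lift of the hypergraph-product code obtained by reading the entries `0, 1` of `H_X` and
`H_Z` as integers, with `1` replaced by `-1` in the right block of `H_Z`. -/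
def hpcLift (H₁ : Matrix K₁ B₁ (ZMod 2)) (H₂ : Matrix K₂ B₂ (ZMod 2)) : ZLift (hpc H₁ H₂) where
  hx := Matrix.fromCols (naiveLift (H₁ ⊗ₖ 1)) (naiveLift (1 ⊗ₖ H₂ᵀ))
  hz := Matrix.fromCols (naiveLift (1 ⊗ₖ H₂)) (-naiveLift (H₁ᵀ ⊗ₖ 1))
  orth := by
    have h := hpc_orth (naiveLift H₁) (naiveLift H₂) (-1) (by norm_num)
    have e₁ : naiveLift H₁ᵀ = (naiveLift H₁)ᵀ := rfl
    have e₂ : naiveLift H₂ᵀ = (naiveLift H₂)ᵀ := rfl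
    simp only [naiveLift_kronecker, naiveLift_one, e₁, e₂]
    rwa [neg_one_smul] at h
  hx_mod := by
    ext i (j | j)
    · exact congrFun (congrFun (naiveLift_mod (H₁ ⊗ₖ (1 : Matrix B₂ B₂ (ZMod 2)))) i) j
    · exact congrFun (congrFun (naiveLift_mod ((1 : Matrix K₁ K₁ (ZMod 2)) ⊗ₖ H₂ᵀ)) i) j
  hz_mod := by
    ext i (j | j)
    · exact congrFun (congrFun (naiveLift_mod ((1 : Matrix B₁ B₁ (ZMod 2)) ⊗ₖ H₂)) i) j
    · have := congrFun (congrFun (naiveLift_mod (H₁ᵀ ⊗ₖ (1 : Matrix K₂ K₂ (ZMod 2)))) i) j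
      simp only [Matrix.map_apply, hpc, Matrix.fromCols_apply_inr, Matrix.neg_apply,
        Int.cast_neg] at this ⊢
      rw [this]
      exact ZMod.neg_eq_self_mod_two _

end HPC

/-! ### Cellular realizations of a `ℤ`-lifted code -/

section Realization

variable {X Q Z : Type u} [Fintype Q] {C : CSSCode X Q Z} (D : ZLift C)

/-- Edges of the `ℤ`-lifted Tanner graph of `h_X`: `|(h_X)_{x,q}|` parallel edges between the
qubit `q` and the check `x`. They are oriented from `q` to `x` and carry the sign of
`(h_X)_{x,q}`. -/
abbrev ZLift.TEdge : Type u := Σ e : X × Q, Fin (D.hx e.1 e.2).natAbs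

/-- The copies of the qubits attached to the check `z`: `|(h_Z)_{z,q}|` copies of `q`. -/
abbrev ZLift.QCopy (z : Z) : Type u := Σ q : Q, Fin (D.hz z q).natAbs

/-- The edges at the copies of the qubits. -/
abbrev ZLift.HalfEdge (z : Z) : Type u :=
  Σ c : D.QCopy z, Σ x : X, Fin (D.hx x c.1).natAbs

def ZLift.halfSign (z : Z) (h : D.HalfEdge z) : ℤ :=
  (D.hz z h.1.1).sign * (D.hx h.2.1 h.1.1).sign

/-- A vertex of the graph `G_z`, obtained by pairing at every `x` the half-edges of opposite signs
and gluing every pair to a new copy of `x`. `Sum.inr h` stands for the copy of `x` in which the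
half-edge `h` ends. -/
abbrev ZLift.GVert (z : Z) : Type u := D.QCopy z ⊕ D.HalfEdge z

/-- The projection from the vertices of `G_z` to the vertices of the lifted Tanner graph. -/
def ZLift.proj (z : Z) : D.GVert z → X ⊕ Q
  | Sum.inl c => Sum.inr c.1
  | Sum.inr h => Sum.inl h.2.1

/-- The vertices of the subgraph of the lifted Tanner graph induced by `z`: the qubits in the
support of `z` and the checks `x` having one of these qubits in their support. -/
def ZLift.InT (z : Z) : X ⊕ Q → Prop
  | Sum.inr q => D.hz z q ≠ 0
  | Sum.inl x => ∃ q, D.hz z q ≠ 0 ∧ D.hx x q ≠ 0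

theorem ZLift.inT_proj (z : Z) (g : D.GVert z) : D.InT z (D.proj z g) := by
  rcases g with c | h
  · intro h0
    have h1 : D.hz z c.1 = 0 := h0
    exact Fin.elim0 (Fin.cast (by rw [h1]; rfl) c.2)
  · refine ⟨h.1.1, fun h1 => ?_, fun h1 => ?_⟩
    · exact Fin.elim0 (Fin.cast (by rw [h1]; rfl) h.1.2)
    · exact Fin.elim0 (Fin.cast (by rw [h1]; rfl) h.2.2)

theorem ZLift.inT_src {z : Z} {e : D.TEdge} (he : D.hz z e.1.2 ≠ 0) :
    D.InT z (Sum.inr e.1.2) := he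

theorem ZLift.inT_tgt {z : Z} {e : D.TEdge} (he : D.hz z e.1.2 ≠ 0) :
    D.InT z (Sum.inl e.1.1) :=
  ⟨e.1.2, he, fun h1 => Fin.elim0 (Fin.cast (by rw [h1]; rfl) e.2)⟩

/-- The one-dimensional part of the dressed handle of the check `z`: the pairing which defines
`G_z`, and the `Z`-type 1-cells which connect the components of `G_z` in a tree-like way. -/
structure HandleFrame (z : Z) where
  pair : D.HalfEdge z → D.HalfEdge z
  pair_pair : ∀ h, pair (pair h) = h
  pair_check : ∀ h, (pair h).2.1 = h.2.1
  pair_sign : ∀ h, D.halfSign z (pair h) = -D.halfSign z h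
  OneCell : Type u
  finite_oneCell : Finite OneCell
  fst : OneCell → D.GVert z
  snd : OneCell → D.GVert z
  /-- The 1-cells connect all components of `G_z`: the relation on the vertices generated by the
  edges of `G_z` and the 1-cells is the total one. -/
  joined : ∀ a b : D.GVert z, Relation.EqvGen (fun a b =>
    (∃ h, a = Sum.inl h.1 ∧ b = Sum.inr h) ∨
    (∃ h, a = Sum.inr h ∧ b = Sum.inr (pair h)) ∨
    (∃ e, a = fst e ∧ b = snd e)) a b
  /-- There is one 1-cell less than there are components of `G_z` (none if `G_z` is empty). -/
  card_oneCell : Nat.card OneCell = Nat.card (Quot fun a b : D.GVert z =>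
    (∃ h, a = Sum.inl h.1 ∧ b = Sum.inr h) ∨
    (∃ h, a = Sum.inr h ∧ b = Sum.inr (pair h))) - 1

/-- The 1-skeleton of the closure of the dressed handle of `z`: the subgraph of the lifted Tanner
graph induced by `z`, together with the `Z`-type 1-cells. -/
def HandleFrame.graph {D : ZLift C} {z : Z} (A : HandleFrame D z) : MultiGraph.{u} where
  V := {v : X ⊕ Q // D.InT z v}
  E := {e : D.TEdge // D.hz z e.1.2 ≠ 0} ⊕ A.OneCell
  src := Sum.elim (fun e => ⟨Sum.inr e.1.1.2, D.inT_src e.2⟩)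
    (fun e => ⟨D.proj z (A.fst e), D.inT_proj z _⟩)
  tgt := Sum.elim (fun e => ⟨Sum.inl e.1.1.1, D.inT_tgt e.2⟩)
    (fun e => ⟨D.proj z (A.snd e), D.inT_proj z _⟩)

/-- The data of the dressed handle of `z`: its 1-cells, and finitely many 2-cells making its
closure simply connected. Its only further cell is the 5-cell of `z`. -/
structure Handle (z : Z) extends HandleFrame D z where
  TwoCell : Type u
  finite_twoCell : Finite TwoCell
  base : TwoCell → toHandleFrame.graph.V
  bdry : TwoCell → List toHandleFrame.graph.Dart
  bdry_closed : ∀ f, toHandleFrame.graph.IsWalk (base f) (base f) (bdry f)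
  simplyConnected :
    (TwoComplex.mk toHandleFrame.graph TwoCell base bdry bdry_closed).SimplyConnected

/-- A cellular realization of a `ℤ`-lifted code: the choice of a dressed handle for every `z`.
The cell complex has one vertex and one 3-cell for every `X`-check `x`, the 3-cell being attached
to the vertex; one vertex and one 4-cell for every qubit `q`, the 4-cell being attached along the
edges at `q` to the 3-cells of the checks `x` with degree `(h_X)_{x,q}`; and for every `Z`-check `z`
the cells of a dressed handle, whose 5-cell is attached with degree `(h_Z)_{z,q}` to the 4-cells.
The 2-skeleton is `Realization.complex`. -/
structure Realization where
  handle : ∀ z : Z, Handle D z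

namespace Realization

variable {D} (R : Realization D)

/-- The inclusion of the edges of the dressed handle of `z` into the edges of the realization. -/
def inclE (z : Z) : (R.handle z).graph.E → D.TEdge ⊕ Σ z : Z, (R.handle z).OneCell
  | Sum.inl e => Sum.inl e.1
  | Sum.inr e => Sum.inr ⟨z, e⟩

/-- The 1-skeleton: the lifted Tanner graph with the `Z`-type 1-cells. -/
abbrev graph : MultiGraph.{u} where
  V := X ⊕ Q
  E := D.TEdge ⊕ Σ z : Z, (R.handle z).OneCell
  src := Sum.elim (fun e => Sum.inr e.1.2) (fun e => D.proj e.1 ((R.handle e.1).fst e.2))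
  tgt := Sum.elim (fun e => Sum.inl e.1.1) (fun e => D.proj e.1 ((R.handle e.1).snd e.2))

theorem isWalk_incl (z : Z) {a b : (R.handle z).graph.V} {l : List (R.handle z).graph.Dart}
    (h : (R.handle z).graph.IsWalk a b l) :
    R.graph.IsWalk a.1 b.1 (l.map (Prod.map (R.inclE z) id)) := by
  induction l generalizing a with
  | nil => exact congrArg Subtype.val h
  | cons d l ih =>
    have hs : R.graph.dsrc (Prod.map (R.inclE z) id d) = ((R.handle z).graph.dsrc d).1 := by
      rcases d with ⟨_ | _, _ | _⟩ <;> rfl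
    have ht : R.graph.dtgt (Prod.map (R.inclE z) id d) = ((R.handle z).graph.dtgt d).1 := by
      rcases d with ⟨_ | _, _ | _⟩ <;> rfl
    refine ⟨hs.trans (congrArg Subtype.val h.1), ?_⟩
    rw [ht]
    exact ih h.2

/-- The 2-skeleton of the realization. -/
abbrev complex : TwoComplex.{u} where
  toMultiGraph := R.graph
  F := Σ z : Z, (R.handle z).TwoCell
  base f := ((R.handle f.1).base f.2).1
  bdry f := ((R.handle f.1).bdry f.2).map (Prod.map (R.inclE f.1) id)
  bdry_closed f := R.isWalk_incl f.1 ((R.handle f.1).bdry_closed f.2)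

end Realization

/-! ### The cellular lift associated with a covering

A covering of the 2-skeleton extends uniquely to the higher cells. The 3-cells and 4-cells of the
covering space lie over the vertices `x'` and `q'`. The closure of the dressed handle of `z` is
simply connected, hence so are the components of its preimage, and each of them carries exactly one
lift of the 5-cell of `z`. -/

namespace Realization

variable {D} {R : Realization D} {v : X ⊕ Q} (c : R.complex.PointedCover v)

/-- The 3-cells of the covering space (lifts of the `X`-checks). -/
abbrev XCell : Type u := Σ x : X, {w : c.total.V // c.p.onV w = Sum.inl x}

/-- The 4-cells of the covering space (lifts of the qubits). -/
abbrev QCell : Type u := Σ q : Q, {w : c.total.V // c.p.onV w = Sum.inr q}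

/-- The vertices over the closure of the dressed handle of `z`. -/
abbrev OverHandle (z : Z) : Type u := {w : c.total.V // D.InT z (c.p.onV w)}

/-- The 5-cells of the covering space (lifts of the `Z`-checks): the connected components of the
preimages of the closures of the dressed handles. -/
abbrev ZCell : Type u :=
  Σ z : Z, Quot fun a b : OverHandle c z =>
    ∃ e : c.total.E, c.p.onE e ∈ Set.range (R.inclE z) ∧ c.total.src e = a.1 ∧ c.total.tgt e = b.1

/-- The closure of the handle of the 5-cell `s` contains the vertex `w`. -/
def ZCell.Mem (s : ZCell c) (w : c.total.V) : Prop :=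
  ∃ h : D.InT s.1 (c.p.onV w), Quot.mk _ ⟨w, h⟩ = s.2

/-- Integral incidence numbers between 4-cells and 3-cells of the covering space: the lifted edges
between `q'` and `x'`, counted with sign. -/
noncomputable def liftX : Matrix (XCell c) (QCell c) ℤ := fun x q =>
  (D.hx x.1 q.1).sign * (Nat.card {e : c.total.E // (∃ t : D.TEdge, c.p.onE e = Sum.inl t) ∧
    c.total.src e = q.2.1 ∧ c.total.tgt e = x.2.1} : ℤ)

open Classical in
/-- Integral incidence numbers between 5-cells and 4-cells of the covering space. -/
noncomputable def liftZ : Matrix (ZCell c) (QCell c) ℤ := fun s q =>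
  if ZCell.Mem c s q.2.1 then D.hz s.1 q.1 else 0

/-- The matrix `H_X` of the cellular lift. -/
noncomputable def codeX : Matrix (XCell c) (QCell c) (ZMod 2) :=
  (liftX c).map (Int.cast : ℤ → ZMod 2)

/-- The matrix `H_Z` of the cellular lift. -/
noncomputable def codeZ : Matrix (ZCell c) (QCell c) (ZMod 2) :=
  (liftZ c).map (Int.cast : ℤ → ZMod 2)

/-- The vertex of the covering space carrying a given 3-cell or 4-cell. -/
def vertexOf : XCell c ⊕ QCell c → c.total.V := Sum.elim (fun x => x.2.1) (fun q => q.2.1)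

/-- The cellular lifts of `C` associated with two pointed coverings (of possibly different
realizations) agree up to relabelling: there are bijections between the `X`-checks, the qubits and
the `Z`-checks, compatible with the projections to those of `C` and with the chosen points, which
carry the parity-check matrices of one code to those of the other. -/
def SameLift {R R' : Realization D} {v : X ⊕ Q} (c : R.complex.PointedCover v)
    (c' : R'.complex.PointedCover v) : Prop :=
  ∃ (eX : XCell c ≃ XCell c') (eQ : QCell c ≃ QCell c') (eZ : ZCell c ≃ ZCell c'),
    (∀ x, (eX x).1 = x.1) ∧ (∀ q, (eQ q).1 = q.1) ∧ (∀ s, (eZ s).1 = s.1) ∧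
    (∀ a, vertexOf c a = c.pt → vertexOf c' (Sum.map eX eQ a) = c'.pt) ∧
    (∀ x q, codeX c' (eX x) (eQ q) = codeX c x q) ∧
    (∀ s q, codeZ c' (eZ s) (eQ q) = codeZ c s q)

end Realization

end Realization

/-! The vertices of a realization are those of the product of the Tanner graphs except the vertices
of `B₁ × K₂`, which are the `Z`-checks. The edges of the lifted Tanner graph are the product edges
avoiding these vertices. Every square of the product has exactly one corner in `B₁ × K₂`, and the
squares around `z` have their other corners in the subgraph of `z`. The simply connected closure of
the handle of `z` thus plays the role of the star of the missing vertex `z`, and `π₁` of every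
realization should be that of the product of the two graphs with all squares filled in.

The argument uses flat group-valued edge labels, that is, labels trivial on boundaries of 2-cells,
instead of a homotopy equivalence. A flat label defines a homomorphism from `π₁`, and on a simply
connected piece it is a coboundary. The label `hpcLabel`, with values in the product of the two
fundamental groups, is the tautological label of the product; it comes with a trivialization around
each `z`, so it extends to every realization at once. Its homomorphism is surjective because paths
of the product can be imitated in the realization, each visit to `z` being replaced by a path in its
handle (`isFull_hpcLabel`). It is injective because the tautological label of the realization,
trivialized over the handles, extends to a flat label on the squares of the product and hence
factors through the product group, up to a change of gauge (`exists_hom_of_squares`,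
`hpc_hom_injective`).

Coverings are classified by subgroups in the usual way (`PointedCover.iso_iff`), so each is
isomorphic to a covering whose sheets are the cosets of its subgroup. There the parity-check
matrices are explicit in terms of the label and the cosets, with no reference to the realization,
which gives orthogonality (`cover_orth`) and independence of the realization (`sameLift_cover`).
Conversely, a bijection preserving the matrices commutes with the transport of sheets along every
path, so it preserves the stabilizer of the base sheet, which is the subgroup (`SameLift.le`). -/

/-! ### Group-valued labels on edge paths -/

section Label

variable {E Γ : Type*} [Group Γ] (m : E → Γ)

/-- The label of an oriented edge, extended from a labelling of the edges by inversion. -/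
def dartLabel (d : E × Bool) : Γ := if d.2 then m d.1 else (m d.1)⁻¹

/-- The label of an edge path: the product of the labels of its oriented edges. -/
def walkLabel (l : List (E × Bool)) : Γ := (l.map (dartLabel m)).prod

@[simp] theorem walkLabel_nil : walkLabel m [] = 1 := rfl

@[simp] theorem walkLabel_cons (d : E × Bool) (l : List (E × Bool)) :
    walkLabel m (d :: l) = dartLabel m d * walkLabel m l := by simp [walkLabel]

@[simp] theorem walkLabel_append (l l' : List (E × Bool)) :
    walkLabel m (l ++ l') = walkLabel m l * walkLabel m l' := by simp [walkLabel]

end Label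

namespace MultiGraph

variable {G : MultiGraph.{u}}

theorem dartLabel_flip {Γ : Type*} [Group Γ] (m : G.E → Γ) (d : G.Dart) :
    dartLabel m (G.flip d) = (dartLabel m d)⁻¹ := by
  rcases d with ⟨e, _ | _⟩ <;> simp [dartLabel, flip]

theorem walkLabel_revWalk {Γ : Type*} [Group Γ] (m : G.E → Γ) (l : List G.Dart) :
    walkLabel m (G.revWalk l) = (walkLabel m l)⁻¹ := by
  induction l with
  | nil => simp [revWalk]
  | cons d l ih => rw [revWalk_cons, walkLabel_append, ih]; simp [dartLabel_flip]

theorem IsWalk.end_unique {a b c : G.V} {l : List G.Dart} (h : G.IsWalk a b l)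
    (h' : G.IsWalk a c l) : b = c := by
  induction l generalizing a with
  | nil => exact h.symm.trans h'
  | cons d l ih => exact ih h.2 h'.2

/-- If the label of every edge is a difference of values of a function on the vertices, then so is
the label of every edge path. -/
theorem IsWalk.label_eq {Γ : Type*} [Group Γ] {m : G.E → Γ} {h : G.V → Γ}
    (hm : ∀ e, m e = (h (G.src e))⁻¹ * h (G.tgt e)) {a b : G.V} {l : List G.Dart}
    (hl : G.IsWalk a b l) : walkLabel m l = (h a)⁻¹ * h b := by
  induction l generalizing a with
  | nil => cases hl; simp
  | cons d l ih =>
    obtain ⟨rfl, h2⟩ := hl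
    rw [walkLabel_cons, ih h2]
    rcases d with ⟨e, _ | _⟩ <;> simp [dartLabel, hm, dsrc, dtgt, mul_assoc]

end MultiGraph

namespace TwoComplex

variable {L : TwoComplex.{u}}

/-- The constant edge path. -/
def Walk.nil (a : L.V) : L.Walk a a := ⟨[], rfl⟩

/-- The edge path of length one given by an oriented edge. -/
def Walk.single (d : L.Dart) : L.Walk (L.dsrc d) (L.dtgt d) := ⟨[d], rfl, rfl⟩

/-- A labelling of the edges is flat if the boundaries of the 2-cells have trivial labels. -/
def IsFlat {Γ : Type*} [Group Γ] (L : TwoComplex.{u}) (m : L.E → Γ) : Prop :=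
  ∀ f, walkLabel m (L.bdry f) = 1

theorem IsFlat.homotopic {Γ : Type*} [Group Γ] {m : L.E → Γ} (hm : L.IsFlat m) {a b : L.V}
    {w w' : L.Walk a b} (h : L.Homotopic w w') : walkLabel m w.1 = walkLabel m w'.1 := by
  induction h with
  | rel w w' h =>
    revert h
    generalize w.1 = l
    generalize w'.1 = l'
    rintro (⟨l, l', d⟩ | ⟨l, l', f⟩)
    · simp [MultiGraph.dartLabel_flip]
    · simp [hm f]
  | refl _ => rfl
  | symm _ _ _ ih => exact ih.symm
  | trans _ _ _ _ _ ih ih' => exact ih.trans ih'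

/-- The homomorphism from the fundamental group defined by a flat labelling. -/
def IsFlat.hom {Γ : Type*} [Group Γ] {m : L.E → Γ} (hm : L.IsFlat m) (v : L.V) :
    L.Pi1 v →* Γ where
  toFun := Quotient.lift (fun w => walkLabel m w.1) fun _ _ h => hm.homotopic h
  map_one' := rfl
  map_mul' := by
    rintro ⟨a⟩ ⟨b⟩
    exact walkLabel_append m _ _

/-- The class of a closed edge path. -/
def Pi1.mk {v : L.V} (w : L.Walk v v) : L.Pi1 v := Quotient.mk (L.loopSetoid v) w

/-! ### The tautological label -/

/-- The label of an edge in the fundamental group, given edge paths from the base point to all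
vertices. -/
def tautLabel {v : L.V} (η : ∀ a, L.Walk v a) (e : L.E) : L.Pi1 v :=
  Pi1.mk (((η (L.src e)).append (Walk.single (e, true))).append (η (L.tgt e)).rev)

theorem Pi1.mk_eq {v : L.V} {w w' : L.Walk v v} : Pi1.mk w = Pi1.mk w' ↔ L.Homotopic w w' :=
  Quotient.eq (r := L.loopSetoid v)

/-- The product telescopes: between consecutive edges the return path to the base point cancels
against the next outgoing one. -/
theorem walkLabel_tautLabel {v : L.V} (η : ∀ a, L.Walk v a) {a b : L.V} (w : L.Walk a b) :
    walkLabel (tautLabel η) w.1 = Pi1.mk (((η a).append w).append (η b).rev) := by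
  obtain ⟨l, hl⟩ := w
  induction l generalizing a with
  | nil =>
    obtain rfl : a = b := hl
    refine Eq.symm (Pi1.mk_eq.2 ?_)
    have e : (η a).append ⟨[], rfl⟩ = η a := Subtype.ext (List.append_nil _)
    rw [e]
    exact Homotopic.append_rev _
  | cons d l ih =>
    obtain ⟨rfl, h2⟩ := hl
    have key : ∀ x y z : L.V, ∀ (p : L.Walk v x) (q : L.Walk x y) (r : L.Walk v y)
        (s : L.Walk y z) (t : L.Walk z v),
        Pi1.mk ((p.append q).append r.rev) * Pi1.mk ((r.append s).append t) =
          Pi1.mk ((p.append (q.append s)).append t) := by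
      intro x y z p q r s t
      refine Pi1.mk_eq.2 ?_
      have := ((Homotopic.refl (p.append q)).append (Homotopic.rev_append r)).append
        (Homotopic.refl (s.append t))
      convert this using 1 <;> exact Subtype.ext (by simp [Walk.append])
    rw [walkLabel_cons, ih h2]
    have hd : dartLabel (tautLabel η) d =
        Pi1.mk (((η (L.dsrc d)).append (Walk.single d)).append (η (L.dtgt d)).rev) := by
      rcases d with ⟨e, _ | _⟩
      · refine congrArg (Pi1.mk (L := L)) (Subtype.ext ?_)
        change L.revWalk ((η (L.src e)).1 ++ [(e, true)] ++ L.revWalk (η (L.tgt e)).1) =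
          (η (L.tgt e)).1 ++ [(e, false)] ++ L.revWalk (η (L.src e)).1
        rw [MultiGraph.revWalk_append, MultiGraph.revWalk_append, MultiGraph.revWalk_revWalk,
          List.append_assoc]
        rfl
      · rfl
    rw [hd]
    exact key _ _ _ (η (L.dsrc d)) (Walk.single d) (η (L.dtgt d)) ⟨l, h2⟩ (η b).rev

theorem isFlat_tautLabel {v : L.V} (η : ∀ a, L.Walk v a) : L.IsFlat (tautLabel η) := by
  intro f
  rw [walkLabel_tautLabel η ⟨L.bdry f, L.bdry_closed f⟩]
  refine Pi1.mk_eq.2 ?_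
  have h1 : L.Homotopic ⟨L.bdry f, L.bdry_closed f⟩ ⟨[], rfl⟩ :=
    Homotopic.symm (.rel _ _ (by simpa using Elem.face (L := L) [] [] f))
  refine (((Homotopic.refl _).append h1).append (Homotopic.refl _)).trans ?_
  have e : (η (L.base f)).append ⟨[], rfl⟩ = η _ := Subtype.ext (List.append_nil _)
  rw [e]
  exact Homotopic.append_rev _

/-- The tautological label of a closed path is its class conjugated by `η a`, and undoing the
conjugation recovers the path. Null-homotopy at any vertex can therefore be tested on labels. -/
theorem homotopic_nil_of_walkLabel {v : L.V} (η : ∀ a, L.Walk v a) {a : L.V} (w : L.Walk a a)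
    (h : walkLabel (tautLabel η) w.1 = 1) : L.Homotopic w ⟨[], rfl⟩ := by
  rw [walkLabel_tautLabel] at h
  have h1 : L.Homotopic _ (Walk.nil v) := Pi1.mk_eq.1 h
  have h2 := ((Homotopic.refl (η a).rev).append h1).append (Homotopic.refl (η a))
  have h3 := (Homotopic.rev_append (η a)).append
    ((Homotopic.refl w).append (Homotopic.rev_append (η a)))
  have e1 : ((Walk.nil a).append (w.append (Walk.nil a))) = w :=
    Subtype.ext (by simp [Walk.append, Walk.nil])
  have e2 : ((η a).rev.append (η a)).append (w.append ((η a).rev.append (η a))) =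
      ((η a).rev.append (((η a).append w).append (η a).rev)).append (η a) :=
    Subtype.ext (by simp [Walk.append])
  have e3 : ((η a).rev.append (Walk.nil v)).append (η a) = (η a).rev.append (η a) :=
    Subtype.ext (by simp [Walk.append, Walk.nil])
  have h3' : L.Homotopic _ w := e1 ▸ h3
  rw [e2] at h3'
  exact h3'.symm.trans ((e3 ▸ h2 : L.Homotopic _ _).trans (Homotopic.rev_append _))

theorem tautLabel_surjective {v : L.V} (η : ∀ a, L.Walk v a) (a : L.V) (g : L.Pi1 v) :
    ∃ w : L.Walk a a, walkLabel (tautLabel η) w.1 = g := by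
  obtain ⟨w, rfl⟩ := Quotient.exists_rep g
  refine ⟨((η a).rev.append w).append (η a), ?_⟩
  rw [walkLabel_tautLabel]
  refine Pi1.mk_eq.2 ?_
  have h := ((Homotopic.append_rev (η a)).append (Homotopic.refl w)).append
    (Homotopic.append_rev (η a))
  convert h using 1 <;> exact Subtype.ext (by simp [Walk.append])

/-! ### Path lifting -/

namespace Map

variable {L' : TwoComplex.{u}} {p : Map L' L}

/-- The edge path `l` lifts to an edge path from `a` to `b`. -/
def LiftsTo (p : Map L' L) (a b : L'.V) (l : List L.Dart) : Prop :=
  ∃ l', L'.IsWalk a b l' ∧ l'.map p.onDart = l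

theorem liftsTo_nil {a b : L'.V} : p.LiftsTo a b [] ↔ a = b :=
  ⟨fun ⟨l', h, e⟩ => by rw [List.map_eq_nil_iff] at e; subst e; exact h, fun h => ⟨[], h, rfl⟩⟩

theorem liftsTo_append {a b : L'.V} {l m : List L.Dart} :
    p.LiftsTo a b (l ++ m) ↔ ∃ c, p.LiftsTo a c l ∧ p.LiftsTo c b m := by
  constructor
  · rintro ⟨l', h, e⟩
    obtain ⟨l₁, l₂, rfl, e1, e2⟩ := List.map_eq_append_iff.1 e
    obtain ⟨c, h1, h2⟩ := h.split
    exact ⟨c, ⟨l₁, h1, e1⟩, ⟨l₂, h2, e2⟩⟩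
  · rintro ⟨c, ⟨l₁, h1, e1⟩, ⟨l₂, h2, e2⟩⟩
    exact ⟨l₁ ++ l₂, h1.append h2, by rw [List.map_append, e1, e2]⟩

theorem onDart_flip (d : L'.Dart) : p.onDart (L'.flip d) = L.flip (p.onDart d) := rfl

theorem LiftsTo.rev {a b : L'.V} {l : List L.Dart} (h : p.LiftsTo a b l) :
    p.LiftsTo b a (L.revWalk l) := by
  obtain ⟨l', h, rfl⟩ := h
  refine ⟨_, h.rev, ?_⟩
  simp [MultiGraph.revWalk, Function.comp_def, onDart_flip]

theorem LiftsTo.isWalk {a b : L'.V} {l : List L.Dart} (h : p.LiftsTo a b l) :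
    L.IsWalk (p.onV a) (p.onV b) l := by
  obtain ⟨l', h, rfl⟩ := h
  exact p.isWalk_map h

theorem IsCovering.lift_unique (hp : p.IsCovering) {a b c : L'.V} {l l' : List L'.Dart}
    (h : L'.IsWalk a b l) (h' : L'.IsWalk a c l') (e : l.map p.onDart = l'.map p.onDart) :
    l = l' := by
  induction l generalizing a l' with
  | nil => exact (List.map_eq_nil_iff.1 e.symm).symm
  | cons d l ih =>
    cases l' with
    | nil => simp at e
    | cons d' l' =>
      simp only [List.map_cons, List.cons.injEq] at e
      obtain ⟨rfl, h2⟩ := h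
      obtain ⟨h1', h2'⟩ := h'
      have hd : d = d' :=
        (hp.1 (L'.dsrc d) (p.onDart d) (p.dsrc_onDart d)).unique ⟨rfl, rfl⟩ ⟨h1', e.1.symm⟩
      subst hd
      rw [ih h2 h2' e.2]

theorem IsCovering.liftsTo_unique (hp : p.IsCovering) {a b c : L'.V} {l : List L.Dart}
    (h : p.LiftsTo a b l) (h' : p.LiftsTo a c l) : b = c := by
  obtain ⟨l₁, h1, rfl⟩ := h
  obtain ⟨l₂, h2, e⟩ := h'
  rw [hp.lift_unique h2 h1 e] at h2
  exact h1.end_unique h2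

theorem IsCovering.exists_lift (hp : p.IsCovering) {a : L'.V} {y : L.V} {l : List L.Dart}
    (h : L.IsWalk (p.onV a) y l) : ∃ b, p.LiftsTo a b l ∧ p.onV b = y := by
  induction l generalizing a with
  | nil => exact ⟨a, liftsTo_nil.2 rfl, h⟩
  | cons d l ih =>
    obtain ⟨d', ⟨rfl, rfl⟩, -⟩ := hp.1 a d h.1
    have h2 := h.2
    rw [p.dtgt_onDart] at h2
    obtain ⟨b, ⟨l', hb, rfl⟩, e⟩ := ih h2
    exact ⟨b, ⟨d' :: l', ⟨rfl, hb⟩, rfl⟩, e⟩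

theorem IsCovering.liftsTo_backtrack (hp : p.IsCovering) {a b : L'.V} {d : L.Dart}
    (hd : L.dsrc d = p.onV a) : p.LiftsTo a b [d, L.flip d] ↔ a = b := by
  obtain ⟨d', ⟨rfl, rfl⟩, -⟩ := hp.1 a d hd
  have h : p.LiftsTo (L'.dsrc d') (L'.dsrc d') [p.onDart d', L.flip (p.onDart d')] :=
    ⟨[d', L'.flip d'], ⟨rfl, MultiGraph.dsrc_flip d', MultiGraph.dtgt_flip d'⟩, rfl⟩
  exact ⟨fun h' => hp.liftsTo_unique h h', fun e => e ▸ h⟩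

theorem IsCovering.liftsTo_bdry (hp : p.IsCovering) {a b : L'.V} {f : L.F} {y : L.V}
    (hf : L.IsWalk (p.onV a) y (L.bdry f)) : p.LiftsTo a b (L.bdry f) ↔ a = b := by
  rcases hl : L.bdry f with _ | ⟨d, l⟩
  -- A 2-cell with empty boundary may be inserted at any vertex, not only at its marked one, so
  -- unique lifting of 2-cells does not apply; the empty path lifts trivially.
  · exact liftsTo_nil
  · have hb := L.bdry_closed f
    rw [hl] at hf hb
    obtain ⟨f', ⟨rfl, rfl⟩, -⟩ := hp.2 a f (hb.1.symm.trans hf.1)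
    rw [← hl]
    have h : p.LiftsTo (L'.base f') (L'.base f') (L.bdry (p.onF f')) :=
      ⟨L'.bdry f', L'.bdry_closed f', (p.bdry_onF f').symm⟩
    exact ⟨fun h' => hp.liftsTo_unique h h', fun e => e ▸ h⟩

/-- The inserted piece, a backtrack or the boundary of a 2-cell, has only closed lifts, so inserting
it does not move the end point of a lift. -/
theorem IsCovering.liftsTo_elem (hp : p.IsCovering) {a b : L'.V} {y : L.V} {l m : List L.Dart}
    (h : L.Elem l m) (hm : L.IsWalk (p.onV a) y m) : p.LiftsTo a b l ↔ p.LiftsTo a b m := by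
  have key : ∀ l r m : List L.Dart, L.IsWalk (p.onV a) y (l ++ (r ++ m)) →
      (∀ c c' y', L.IsWalk (p.onV c) y' r → (p.LiftsTo c c' r ↔ c = c')) →
      (p.LiftsTo a b (l ++ m) ↔ p.LiftsTo a b (l ++ (r ++ m))) := by
    intro l r m hw hr
    obtain ⟨x, h1, h2⟩ := hw.split
    obtain ⟨x', h3, h4⟩ := h2.split
    obtain ⟨c, hc, rfl⟩ := hp.exists_lift h1
    simp only [liftsTo_append]
    constructor
    · rintro ⟨c', h5, h6⟩
      cases hp.liftsTo_unique hc h5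
      exact ⟨c, hc, c, (hr c c x' h3).2 rfl, h6⟩
    · rintro ⟨c', h5, c'', h6, h7⟩
      cases hp.liftsTo_unique hc h5
      cases (hr c c'' x' h3).1 h6
      exact ⟨c, hc, h7⟩
  cases h with
  | cancel l m d => exact key l _ m hm fun c c' y' h => hp.liftsTo_backtrack h.1
  | face l m f => exact key l _ m hm fun c c' y' h => hp.liftsTo_bdry h

theorem IsCovering.liftsTo_homotopic (hp : p.IsCovering) {x y : L.V} {w w' : L.Walk x y}
    (h : L.Homotopic w w') {a b : L'.V} (hx : p.onV a = x) :
    p.LiftsTo a b w.1 ↔ p.LiftsTo a b w'.1 := by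
  subst hx
  induction h with
  | rel w w' h => exact hp.liftsTo_elem h w'.2
  | refl _ => rfl
  | symm _ _ _ ih => exact ih.symm
  | trans _ _ _ _ _ ih ih' => exact ih.trans ih'

/-- Composition of cellular maps. -/
def comp {L'' : TwoComplex.{u}} (p : Map L' L) (q : Map L'' L') : Map L'' L where
  onV := p.onV ∘ q.onV
  onE := p.onE ∘ q.onE
  onF := p.onF ∘ q.onF
  src_onE e := by simp [p.src_onE, q.src_onE]
  tgt_onE e := by simp [p.tgt_onE, q.tgt_onE]
  base_onF f := by simp [p.base_onF, q.base_onF]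
  bdry_onF f := by simp [p.bdry_onF, q.bdry_onF]

/-- A cellular map over `L`. -/
def Over {L'' : TwoComplex.{u}} (p : Map L' L) (q : Map L'' L) (f : Map L' L'') : Prop :=
  q.onV ∘ f.onV = p.onV ∧ q.onE ∘ f.onE = p.onE ∧ q.onF ∘ f.onF = p.onF

theorem Over.comp {M M' : TwoComplex.{u}} {p : Map L' L} {q : Map M L} {r : Map M' L}
    {g : Map M M'} {f : Map L' M} (hg : Over q r g) (hf : Over p q f) : Over p r (g.comp f) :=
  ⟨(congrArg (· ∘ f.onV) hg.1).trans hf.1, (congrArg (· ∘ f.onE) hg.2.1).trans hf.2.1,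
    (congrArg (· ∘ f.onF) hg.2.2).trans hf.2.2⟩

theorem Over.liftsTo {L'' : TwoComplex.{u}} {q : Map L'' L} {f : Map L' L''} (hf : Over p q f)
    {a b : L'.V} {l : List L.Dart} (h : p.LiftsTo a b l) :
    q.LiftsTo (f.onV a) (f.onV b) l := by
  obtain ⟨l', h, rfl⟩ := h
  refine ⟨_, f.isWalk_map h, ?_⟩
  rw [List.map_map]
  refine List.map_congr_left fun d _ => ?_
  exact Prod.ext (congrFun hf.2.1 d.1) rfl

/-- Uniqueness of path lifting propagates the fixed vertex to all vertices by connectedness; unique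
lifts of edges and 2-cells do the rest. -/
theorem IsCovering.over_self_eq_id (hp : p.IsCovering) (hc : L'.Connected) {s : Map L' L'}
    (hs : Over p p s) {a : L'.V} (ha : s.onV a = a) :
    s.onV = id ∧ s.onE = id ∧ s.onF = id := by
  have hV : s.onV = id := by
    funext b
    obtain ⟨l, hl⟩ := hc.2 a b
    have h1 : p.LiftsTo a b (l.map p.onDart) := ⟨l, hl, rfl⟩
    have h2 := hs.liftsTo h1
    rw [ha] at h2
    exact hp.liftsTo_unique h2 h1
  refine ⟨hV, ?_, ?_⟩
  · funext e
    have h := (hp.1 (L'.src e) (p.onE e, true) (p.src_onE e)).unique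
      (y₁ := (s.onE e, true)) (y₂ := (e, true))
      ⟨(s.src_onE e).trans (congrFun hV _), Prod.ext (congrFun hs.2.1 e) rfl⟩ ⟨rfl, rfl⟩
    exact congrArg Prod.fst h
  · funext f
    exact (hp.2 (L'.base f) (p.onF f) (p.base_onF f)).unique
      ⟨(s.base_onF f).trans (congrFun hV _), congrFun hs.2.2 f⟩ ⟨rfl, rfl⟩

end Map

/-! ### Classification of pointed coverings by subgroups -/

namespace PointedCover

variable {v : L.V}

/-- Membership as closedness of a lift, which avoids the transport along `pt_over` in the definition
of the subgroup. One direction is homotopy lifting. -/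
theorem mk_mem_subgroup (c : L.PointedCover v) (w : L.Walk v v) :
    Pi1.mk w ∈ c.subgroup ↔ c.p.LiftsTo c.pt c.pt w.1 := by
  obtain ⟨M, p, hp, hc, a, rfl⟩ := c
  constructor
  · rintro ⟨⟨w'⟩, hw⟩
    have h : L.Homotopic (p.mapWalk w') w := Pi1.mk_eq.1 hw
    exact (hp.liftsTo_homotopic h rfl).1 ⟨w'.1, w'.2, rfl⟩
  · rintro ⟨l, hl, e⟩
    exact ⟨Pi1.mk ⟨l, hl⟩, congrArg (Pi1.mk (L := L)) (Subtype.ext e)⟩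

/-- The lifting criterion: a vertex `a` is sent to the end point in `d` of the lift of the image of
any path from `c.pt` to `a`. -/
theorem exists_over (c d : L.PointedCover v) (h : c.subgroup ≤ d.subgroup) :
    ∃ f : Map c.total d.total, Map.Over c.p d.p f ∧ f.onV c.pt = d.pt := by
  have hpt : c.p.onV c.pt = d.p.onV d.pt := c.pt_over.trans d.pt_over.symm
  have hex : ∀ a, ∃ b, ∃ l, c.total.IsWalk c.pt a l ∧ d.p.LiftsTo d.pt b (l.map c.p.onDart) := by
    intro a
    obtain ⟨l, hl⟩ := c.connected.2 c.pt a
    have hw := c.p.isWalk_map hl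
    rw [hpt] at hw
    obtain ⟨b, hb, -⟩ := d.isCovering.exists_lift hw
    exact ⟨b, l, hl, hb⟩
  have huniq : ∀ a b b' l l', c.total.IsWalk c.pt a l → c.total.IsWalk c.pt a l' →
      d.p.LiftsTo d.pt b (l.map c.p.onDart) → d.p.LiftsTo d.pt b' (l'.map c.p.onDart) →
      b = b' := by
    intro a b b' l l' hl hl' hb hb'
    -- Independence of the path: going out along `l` and back along `l'` is a loop in `c`, so its
    -- image has its class in `c.subgroup`, hence in `d.subgroup`, and its lift to `d` closes up.
    have h1 : c.p.LiftsTo c.pt c.pt (l.map c.p.onDart ++ L.revWalk (l'.map c.p.onDart)) :=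
      Map.liftsTo_append.2 ⟨a, ⟨l, hl, rfl⟩, Map.LiftsTo.rev ⟨l', hl', rfl⟩⟩
    have hw := h1.isWalk
    rw [c.pt_over] at hw
    have h2 := (d.mk_mem_subgroup ⟨_, hw⟩).1 (h ((c.mk_mem_subgroup ⟨_, hw⟩).2 h1))
    obtain ⟨b'', h3, h4⟩ := Map.liftsTo_append.1 h2
    have h5 := h4.rev
    rw [MultiGraph.revWalk_revWalk] at h5
    rw [d.isCovering.liftsTo_unique hb h3, d.isCovering.liftsTo_unique hb' h5]
  choose fV wl hwl hfV using hex
  have hover : ∀ a, d.p.onV (fV a) = c.p.onV a := by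
    intro a
    have h1 := (hfV a).isWalk
    have h2 := c.p.isWalk_map (hwl a)
    rw [d.pt_over] at h1
    rw [c.pt_over] at h2
    exact h1.end_unique h2
  have hstep : ∀ a b l, c.total.IsWalk a b l → d.p.LiftsTo (fV a) (fV b) (l.map c.p.onDart) := by
    intro a b l hl
    have hw := c.p.isWalk_map hl
    rw [← hover a] at hw
    obtain ⟨b', hb', -⟩ := d.isCovering.exists_lift hw
    have : fV b = b' := huniq b _ _ _ _ (hwl b) ((hwl a).append hl) (hfV b)
      (by rw [List.map_append]; exact Map.liftsTo_append.2 ⟨_, hfV a, hb'⟩)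
    rwa [this]
  have hE : ∀ e, ∃ e', d.total.src e' = fV (c.total.src e) ∧
      d.total.tgt e' = fV (c.total.tgt e) ∧ d.p.onE e' = c.p.onE e := by
    intro e
    obtain ⟨l, hl, he⟩ := hstep (c.total.src e) (c.total.tgt e) [(e, true)] ⟨rfl, rfl⟩
    obtain ⟨d', rfl, he'⟩ := List.map_eq_singleton_iff.1 he
    obtain ⟨e', s⟩ := d'
    obtain ⟨h1, h2⟩ := Prod.mk.inj he'
    cases h2
    exact ⟨e', hl.1, hl.2, h1⟩
  choose fE hsrc htgt hEover using hE
  have hF : ∀ f, ∃ f', d.total.base f' = fV (c.total.base f) ∧ d.p.onF f' = c.p.onF f := fun f =>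
    (d.isCovering.2 (fV (c.total.base f)) (c.p.onF f)
      ((c.p.base_onF f).trans (hover _).symm)).exists
  choose fF hbase hFover using hF
  have hwalk : ∀ a b l, c.total.IsWalk a b l →
      d.total.IsWalk (fV a) (fV b) (l.map (Prod.map fE id)) := by
    intro a b l hl
    induction l generalizing a with
    | nil => exact congrArg fV hl
    | cons x l ih =>
      obtain ⟨rfl, h2⟩ := hl
      have := ih _ h2
      rcases x with ⟨e, _ | _⟩
      · exact ⟨htgt e, (congrArg (d.total.IsWalk · _ _) (hsrc e)).mpr this⟩
      · exact ⟨hsrc e, (congrArg (d.total.IsWalk · _ _) (htgt e)).mpr this⟩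
  refine ⟨⟨fV, fE, fF, hsrc, htgt, hbase, fun f => ?_⟩,
    ⟨funext hover, funext hEover, funext hFover⟩, ?_⟩
  · have h1 := d.total.bdry_closed (fF f)
    rw [hbase] at h1
    -- Both sides lift the same boundary path from the same vertex of `d`.
    refine d.isCovering.lift_unique h1 (hwalk _ _ _ (c.total.bdry_closed f)) ?_
    have e1 := d.p.bdry_onF (fF f)
    have e2 := c.p.bdry_onF f
    rw [hFover, e2] at e1
    refine e1.symm.trans ?_
    rw [List.map_map]
    exact List.map_congr_left fun x _ => Prod.ext (hEover x.1).symm rfl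
  · exact huniq c.pt _ _ _ [] (hwl _) rfl (hfV _) (Map.liftsTo_nil.2 rfl)

/-- For equal subgroups the lifting criterion gives maps in both directions; their composites over
`L` fix the chosen points and are therefore identities. -/
theorem iso_iff (c d : L.PointedCover v) : c.Iso d ↔ c.subgroup = d.subgroup := by
  constructor
  · rintro ⟨f, hb, ho, hpt⟩
    have ho' : Map.Over c.p d.p f := ho
    ext ⟨w⟩
    refine (c.mk_mem_subgroup w).trans (Iff.trans ?_ (d.mk_mem_subgroup w).symm)
    constructor
    · intro h
      have := ho'.liftsTo h
      rwa [hpt] at this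
    · intro h
      have hw := w.2
      nth_rw 1 [← c.pt_over] at hw
      obtain ⟨b, h1, -⟩ := c.isCovering.exists_lift hw
      have h2 := ho'.liftsTo h1
      rw [hpt] at h2
      have h3 : f.onV b = f.onV c.pt := (d.isCovering.liftsTo_unique h2 h).trans hpt.symm
      rwa [hb.1.1 h3] at h1
  · intro h
    obtain ⟨f, hf, hfp⟩ := exists_over c d h.le
    obtain ⟨g, hg, hgp⟩ := exists_over d c h.ge
    have hgf : Map.Over c.p c.p (g.comp f) := hg.comp hf
    have hfg : Map.Over d.p d.p (f.comp g) := hf.comp hg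
    obtain ⟨a1, a2, a3⟩ := c.isCovering.over_self_eq_id c.connected hgf (a := c.pt)
      (by simp [Map.comp, hfp, hgp])
    obtain ⟨b1, b2, b3⟩ := d.isCovering.over_self_eq_id d.connected hfg (a := d.pt)
      (by simp [Map.comp, hfp, hgp])
    exact ⟨f, ⟨Function.bijective_iff_has_inverse.2 ⟨g.onV, congrFun a1, congrFun b1⟩,
      Function.bijective_iff_has_inverse.2 ⟨g.onE, congrFun a2, congrFun b2⟩,
      Function.bijective_iff_has_inverse.2 ⟨g.onF, congrFun a3, congrFun b3⟩⟩, hf, hfp⟩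

end PointedCover

end TwoComplex

namespace TwoComplex

/-! ### The covering defined by a flat label and an action -/

section LabelCover

variable {L : TwoComplex.{u}} {Γ : Type u} [Group Γ] {m : L.E → Γ} {S : Type u} [MulAction Γ S]

/-- The lift of an edge path to the covering defined by a label, starting on the sheet `s`. -/
def liftList (m : L.E → Γ) : S → List L.Dart → List ((L.E × S) × Bool)
  | _, [] => []
  -- A lifted edge is indexed by the sheet of its source. Traversed backwards from sheet `s` over
  -- its target, it has its source on sheet `m d.1 • s`.
  | s, d :: l => ((d.1, if d.2 then s else m d.1 • s), d.2) ::
      liftList m ((dartLabel m d)⁻¹ • s) l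

variable (m S) in
/-- The 1-skeleton of the covering defined by a label. -/
def labelGraph : MultiGraph.{u} where
  V := L.V × S
  E := L.E × S
  src e := (L.src e.1, e.2)
  tgt e := (L.tgt e.1, (m e.1)⁻¹ • e.2)

theorem isWalk_liftList {a b : L.V} {l : List L.Dart} (h : L.IsWalk a b l) (s : S) :
    (labelGraph m S).IsWalk (a, s) (b, (walkLabel m l)⁻¹ • s) (liftList m s l) := by
  induction l generalizing a s with
  | nil =>
    cases h
    rw [walkLabel_nil, inv_one, one_smul]
    rfl
  | cons d l ih =>
    obtain ⟨rfl, h2⟩ := h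
    have h3 := ih h2 ((dartLabel m d)⁻¹ • s)
    rw [smul_smul, ← mul_inv_rev, ← walkLabel_cons] at h3
    rcases d with ⟨e, _ | _⟩
    · refine ⟨Prod.ext rfl (inv_smul_smul (m e) s), ?_⟩
      have h4 : (labelGraph m S).dtgt ((e, m e • s), false) =
          (L.dtgt (e, false), (dartLabel m (e, false))⁻¹ • s) :=
        Prod.ext rfl (congrArg (· • s) (inv_inv (m e)).symm)
      exact (congrArg ((labelGraph m S).IsWalk · _ _) h4).mpr h3
    · exact ⟨rfl, h3⟩

theorem map_liftList (s : S) (l : List L.Dart) :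
    (liftList m s l).map (Prod.map Prod.fst id) = l := by
  induction l generalizing s with
  | nil => rfl
  | cons d l ih => exact congrArg (d :: ·) (ih _)

variable (S) in
/-- The covering defined by a flat label and an action of its group of values. -/
def labelCover (hm : L.IsFlat m) : TwoComplex.{u} where
  toMultiGraph := labelGraph m S
  F := L.F × S
  base f := (L.base f.1, f.2)
  bdry f := liftList m f.2 (L.bdry f.1)
  bdry_closed f := by
    have h := isWalk_liftList (m := m) (L.bdry_closed f.1) f.2
    rwa [hm, inv_one, one_smul] at h

variable (S) in
/-- The projection of the covering defined by a flat label. -/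
def labelProj (hm : L.IsFlat m) : Map (labelCover S hm) L where
  onV := Prod.fst
  onE := Prod.fst
  onF := Prod.fst
  src_onE _ := rfl
  tgt_onE _ := rfl
  base_onF _ := rfl
  bdry_onF f := (map_liftList f.2 _).symm

theorem isCovering_labelProj (hm : L.IsFlat m) : (labelProj S hm).IsCovering := by
  constructor
  · rintro ⟨a, s⟩ d rfl
    rcases d with ⟨e, _ | _⟩
    · refine ⟨((e, m e • s), false), ⟨Prod.ext rfl (inv_smul_smul (m e) s), rfl⟩, ?_⟩
      rintro ⟨⟨e', s'⟩, b⟩ ⟨h1, h2⟩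
      obtain ⟨rfl, rfl⟩ := Prod.mk.inj h2
      have h3 : (m e')⁻¹ • s' = s := congrArg Prod.snd h1
      have h4 : s' = m e' • s := by rw [← h3, smul_inv_smul]
      subst h4
      rfl
    · refine ⟨((e, s), true), ⟨rfl, rfl⟩, ?_⟩
      rintro ⟨⟨e', s'⟩, b⟩ ⟨h1, h2⟩
      obtain ⟨rfl, rfl⟩ := Prod.mk.inj h2
      have h3 : s' = s := congrArg Prod.snd h1
      subst h3
      rfl
  · rintro ⟨a, s⟩ f rfl
    refine ⟨(f, s), ⟨rfl, rfl⟩, ?_⟩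
    rintro ⟨f', s'⟩ ⟨h1, rfl⟩
    exact Prod.ext rfl (show s' = s from congrArg Prod.snd h1)

/-- In these coverings lifting a path is transport of sheets by the inverse of its label; unique
lifting excludes any other end point. -/
theorem liftsTo_labelProj (hm : L.IsFlat m) {a b : L.V} {s s' : S} {l : List L.Dart} :
    (labelProj S hm).LiftsTo (a, s) (b, s') l ↔ L.IsWalk a b l ∧ s' = (walkLabel m l)⁻¹ • s := by
  have key : ∀ y, L.IsWalk a y l →
      (labelProj S hm).LiftsTo (a, s) (y, (walkLabel m l)⁻¹ • s) l :=
    fun y h => ⟨_, isWalk_liftList h s, map_liftList s l⟩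
  constructor
  · intro h
    exact ⟨h.isWalk,
      congrArg Prod.snd ((isCovering_labelProj hm).liftsTo_unique h (key b h.isWalk))⟩
  · rintro ⟨h, rfl⟩
    exact key b h

/-- Any two vertices are joined by edge paths of every label. -/
def IsFull (L : TwoComplex.{u}) (m : L.E → Γ) : Prop :=
  ∀ (a b : L.V) (g : Γ), ∃ l, L.IsWalk a b l ∧ walkLabel m l = g

theorem IsFull.connected_labelCover (hm : L.IsFlat m) (hf : L.IsFull m)
    [MulAction.IsPretransitive Γ S] (v : L.V) (s₀ : S) : (labelCover S hm).Connected := by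
  refine ⟨⟨(v, s₀)⟩, ?_⟩
  rintro ⟨a, s⟩ ⟨b, s'⟩
  obtain ⟨g, rfl⟩ := MulAction.exists_smul_eq Γ s s'
  obtain ⟨l, hl, h⟩ := hf a b g⁻¹
  obtain ⟨l', hl', -⟩ := (liftsTo_labelProj hm (s := s) (s' := g • s)).2
    ⟨hl, by rw [h, inv_inv]⟩
  exact ⟨l', hl'⟩

/-- The connected pointed covering whose sheets are the cosets of `H`. -/
def cosetCover (hm : L.IsFlat m) (hf : L.IsFull m) (v : L.V) (H : Subgroup Γ) :
    L.PointedCover v where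
  total := labelCover (Γ ⧸ H) hm
  p := labelProj (Γ ⧸ H) hm
  isCovering := isCovering_labelProj hm
  connected := hf.connected_labelCover hm v ((1 : Γ) : Γ ⧸ H)
  pt := (v, ((1 : Γ) : Γ ⧸ H))
  pt_over := rfl

/-- A loop lifts to a loop at the trivial coset exactly when its label fixes that coset, that is,
lies in `H`; fullness ensures that every element of `H` is the label of a loop. -/
theorem map_subgroup_cosetCover (hm : L.IsFlat m) (hf : L.IsFull m) (v : L.V) (H : Subgroup Γ)
    (Φ : L.Pi1 v →* Γ) (hΦ : ∀ w, Φ (Pi1.mk w) = walkLabel m w.1) :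
    (cosetCover hm hf v H).subgroup.map Φ = H := by
  have key : ∀ w : L.Walk v v, Pi1.mk w ∈ (cosetCover hm hf v H).subgroup ↔
      walkLabel m w.1 ∈ H := by
    intro w
    refine (PointedCover.mk_mem_subgroup _ w).trans ((liftsTo_labelProj hm).trans ?_)
    rw [and_iff_right w.2, MulAction.Quotient.smul_coe, QuotientGroup.eq, inv_one, one_mul,
      smul_eq_mul, mul_one, inv_mem_iff]
  ext g
  constructor
  · rintro ⟨⟨w⟩, hw, rfl⟩
    have := (key w).1 hw
    rwa [← hΦ] at this
  · intro hg
    obtain ⟨l, hl, rfl⟩ := hf v v g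
    exact ⟨Pi1.mk ⟨l, hl⟩, (key ⟨l, hl⟩).2 hg, hΦ _⟩

end LabelCover

end TwoComplex

/-! ### Cellular lifts of isomorphic coverings -/

namespace Realization

variable {X Q Z : Type u} [Fintype Q] {C : CSSCode X Q Z} {D : ZLift C}

section SameLift

variable {R R' R'' : Realization D} {v : X ⊕ Q} {c : R.complex.PointedCover v}
  {c' : R'.complex.PointedCover v} {c'' : R''.complex.PointedCover v}

theorem vertexOf_injective : Function.Injective (vertexOf c) := by
  rintro (⟨x, w, hw⟩ | ⟨q, w, hw⟩) (⟨x', w', hw'⟩ | ⟨q', w', hw'⟩) h <;>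
    obtain rfl : w = w' := h
  · obtain rfl : x = x' := Sum.inl.inj (hw.symm.trans hw')
    rfl
  · exact absurd (hw.symm.trans hw') Sum.inl_ne_inr
  · exact absurd (hw.symm.trans hw') Sum.inr_ne_inl
  · obtain rfl : q = q' := Sum.inr.inj (hw.symm.trans hw')
    rfl

theorem vertexOf_surjective : Function.Surjective (vertexOf c) := by
  intro w
  rcases h : c.p.onV w with x | q
  · exact ⟨Sum.inl ⟨x, w, h⟩, rfl⟩
  · exact ⟨Sum.inr ⟨q, w, h⟩, rfl⟩

theorem SameLift.symm (h : SameLift c c') : SameLift c' c := by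
  obtain ⟨eX, eQ, eZ, hX, hQ, hZ, hpt, hcX, hcZ⟩ := h
  refine ⟨eX.symm, eQ.symm, eZ.symm, fun x => ?_, fun q => ?_, fun s => ?_, fun a ha => ?_,
    fun x q => ?_, fun s q => ?_⟩
  · rw [← hX, eX.apply_symm_apply]
  · rw [← hQ, eQ.apply_symm_apply]
  · rw [← hZ, eZ.apply_symm_apply]
  · obtain ⟨b, hb⟩ := vertexOf_surjective (c := c) c.pt
    have h1 : Sum.map eX eQ b = a := vertexOf_injective ((hpt b hb).trans ha.symm)
    rw [← h1, Sum.map_map, eX.symm_comp_self, eQ.symm_comp_self, Sum.map_id_id]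
    exact hb
  · rw [← hcX, eX.apply_symm_apply, eQ.apply_symm_apply]
  · rw [← hcZ, eZ.apply_symm_apply, eQ.apply_symm_apply]

theorem SameLift.trans (h : SameLift c c') (h' : SameLift c' c'') : SameLift c c'' := by
  obtain ⟨eX, eQ, eZ, hX, hQ, hZ, hpt, hcX, hcZ⟩ := h
  obtain ⟨fX, fQ, fZ, hX', hQ', hZ', hpt', hcX', hcZ'⟩ := h'
  refine ⟨eX.trans fX, eQ.trans fQ, eZ.trans fZ, fun x => (hX' _).trans (hX x),
    fun q => (hQ' _).trans (hQ q), fun s => (hZ' _).trans (hZ s), fun a ha => ?_,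
    fun x q => (hcX' _ _).trans (hcX x q), fun s q => (hcZ' _ _).trans (hcZ s q)⟩
  have := hpt' _ (hpt a ha)
  rwa [Sum.map_map] at this

/-- An isomorphism of coverings preserves lifted edges and hence the components over each handle, so
the incidence numbers agree. This reduces statements about lifts to coset coverings. -/
theorem sameLift_of_iso {c d : R.complex.PointedCover v} (h : c.Iso d) : SameLift c d := by
  obtain ⟨f, ⟨hbV, hbE, -⟩, ⟨hV, hE, -⟩, hpt⟩ := h
  have hV' : ∀ w, d.p.onV (f.onV w) = c.p.onV w := congrFun hV
  have hE' : ∀ e, d.p.onE (f.onE e) = c.p.onE e := congrFun hE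
  let eV := Equiv.ofBijective f.onV hbV
  let eE := Equiv.ofBijective f.onE hbE
  let eT : ∀ z, OverHandle c z ≃ OverHandle d z := fun z =>
    eV.subtypeEquiv fun w => by rw [← hV' w]; rfl
  have hrel : ∀ z (a b : OverHandle c z),
      (∃ e : c.total.E, c.p.onE e ∈ Set.range (R.inclE z) ∧ c.total.src e = a.1 ∧
        c.total.tgt e = b.1) ↔
      ∃ e : d.total.E, d.p.onE e ∈ Set.range (R.inclE z) ∧ d.total.src e = (eT z a).1 ∧
        d.total.tgt e = (eT z b).1 := by
    intro z a b
    constructor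
    · rintro ⟨e, h1, h2, h3⟩
      exact ⟨f.onE e, by rwa [hE'], (f.src_onE e).trans (congrArg f.onV h2),
        (f.tgt_onE e).trans (congrArg f.onV h3)⟩
    · rintro ⟨e, h1, h2, h3⟩
      obtain ⟨e, rfl⟩ := hbE.2 e
      rw [hE'] at h1
      rw [f.src_onE] at h2
      rw [f.tgt_onE] at h3
      exact ⟨e, h1, hbV.1 h2, hbV.1 h3⟩
  refine ⟨Equiv.sigmaCongrRight fun x => eV.subtypeEquiv fun w => by rw [← hV' w]; rfl,
    Equiv.sigmaCongrRight fun q => eV.subtypeEquiv fun w => by rw [← hV' w]; rfl,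
    Equiv.sigmaCongrRight fun z => Quot.congr (eT z) (hrel z),
    fun _ => rfl, fun _ => rfl, fun _ => rfl, ?_, ?_, ?_⟩
  · rintro (⟨x, w, hw⟩ | ⟨q, w, hw⟩) h <;> exact (congrArg f.onV h).trans hpt
  · rintro ⟨x, w, hw⟩ ⟨q, y, hy⟩
    refine congrArg (Int.cast : ℤ → ZMod 2) ?_
    refine congrArg (fun n : ℕ => (D.hx x q).sign * (n : ℤ)) (Nat.card_congr ?_).symm
    refine eE.subtypeEquiv fun e => ?_
    change _ ↔ (∃ t, d.p.onE (f.onE e) = Sum.inl t) ∧ d.total.src (f.onE e) = f.onV y ∧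
      d.total.tgt (f.onE e) = f.onV w
    rw [hE', f.src_onE, f.tgt_onE, hbV.1.eq_iff, hbV.1.eq_iff]
  · rintro ⟨z, s⟩ ⟨q, y, hy⟩
    refine congrArg (Int.cast : ℤ → ZMod 2) ?_
    classical
    refine if_congr ?_ rfl rfl
    constructor
    · rintro ⟨h, h1⟩
      have h' : D.InT z (c.p.onV y) := by rw [← hV' y]; exact h
      exact ⟨h', (Quot.congr (eT z) (hrel z)).injective h1⟩
    · rintro ⟨h, h1⟩
      exact ⟨by change D.InT z (d.p.onV (f.onV y)); rw [hV']; exact h,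
        congrArg (Quot.congr (eT z) (hrel z)) h1⟩

theorem SameLift.orth [Fintype (QCell c)] (h : SameLift c c')
    (h' : ∀ [Fintype (QCell c')], codeX c' * (codeZ c')ᵀ = 0) : codeX c * (codeZ c)ᵀ = 0 := by
  obtain ⟨eX, eQ, eZ, -, -, -, -, hcX, hcZ⟩ := h
  let _ : Fintype (QCell c') := Fintype.ofEquiv _ eQ
  ext x s
  have h1 := congrFun (congrFun h' (eX x)) (eZ s)
  rw [Matrix.mul_apply] at h1 ⊢
  rw [← Equiv.sum_comp eQ] at h1
  refine Eq.trans (Finset.sum_congr rfl fun q _ => ?_) h1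
  rw [Matrix.transpose_apply, Matrix.transpose_apply, hcX, hcZ]

end SameLift

/-! ### Labels of realizations -/

/-- A label of the edges of the lifted Tanner graph, with a trivialization over the subgraph of
every `Z`-check. -/
structure _root_.ZLift.Label (D : ZLift C) (Γ : Type u) [Group Γ] where
  edge : X → Q → Γ
  triv : Z → X ⊕ Q → Γ
  edge_eq : ∀ x q z, D.hx x q ≠ 0 → D.hz z q ≠ 0 →
    edge x q = (triv z (Sum.inr q))⁻¹ * triv z (Sum.inl x)

theorem _root_.ZLift.TEdge.hx_ne_zero (t : D.TEdge) : D.hx t.1.1 t.1.2 ≠ 0 :=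
  fun h => Fin.elim0 (Fin.cast (by rw [h]; rfl) t.2)

variable {Γ : Type u} [Group Γ] (Λ : D.Label Γ) (R : Realization D)

/-- The label of the edges of a realization. -/
def label : R.complex.E → Γ :=
  Sum.elim (fun t => Λ.edge t.1.1 t.1.2) fun e =>
    (Λ.triv e.1 (D.proj e.1 ((R.handle e.1).fst e.2)))⁻¹ *
      Λ.triv e.1 (D.proj e.1 ((R.handle e.1).snd e.2))

variable {Λ R}

theorem label_inclE (z : Z) (e : (R.handle z).graph.E) :
    R.label Λ (R.inclE z e) = (Λ.triv z ((R.handle z).graph.src e).1)⁻¹ *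
      Λ.triv z ((R.handle z).graph.tgt e).1 := by
  rcases e with ⟨t, ht⟩ | e
  · exact Λ.edge_eq _ _ _ t.hx_ne_zero ht
  · rfl

theorem walkLabel_incl (z : Z) {a b : (R.handle z).graph.V} {l : List (R.handle z).graph.Dart}
    (hl : (R.handle z).graph.IsWalk a b l) :
    walkLabel (R.label Λ) (l.map (Prod.map (R.inclE z) id)) =
      (Λ.triv z a.1)⁻¹ * Λ.triv z b.1 := by
  rw [← hl.label_eq (m := fun e => R.label Λ (R.inclE z e)) (h := fun a => Λ.triv z a.1)
    (label_inclE z), walkLabel, walkLabel, List.map_map]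
  rfl

/-- The boundary of a 2-cell is a closed path inside one handle, where the label is a coboundary. -/
theorem isFlat_label : R.complex.IsFlat (R.label Λ) := by
  rintro ⟨z, f⟩
  exact (walkLabel_incl z ((R.handle z).bdry_closed f)).trans (inv_mul_cancel _)

theorem handle_preconnected (R : Realization D) (z : Z) : (R.handle z).graph.Preconnected :=
  (R.handle z).simplyConnected.1

/-! ### The cellular lift of a coset covering -/

section CosetCover

variable (hf : R.complex.IsFull (R.label Λ)) (v : X ⊕ Q) (H : Subgroup Γ)

/-- The coset covering of a realization. -/
abbrev cover : R.complex.PointedCover v :=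
  TwoComplex.cosetCover (isFlat_label (Λ := Λ)) hf v H

-- The lifted edges between the two vertices are the lifts, starting on sheet `s'`, of the edges
-- from `q` to `x`; they all have the same label, so either all or none end on sheet `s`.
open Classical in
theorem liftX_cover (x : X) (q : Q) (s s' : Γ ⧸ H) :
    liftX (cover hf v H) ⟨x, (Sum.inl x, s), rfl⟩ ⟨q, (Sum.inr q, s'), rfl⟩ =
      if s' = Λ.edge x q • s then D.hx x q else 0 := by
  unfold liftX
  dsimp only
  by_cases h : s' = Λ.edge x q • s
  · have e : {e : (cover hf v H).total.E // (∃ t : D.TEdge, (cover hf v H).p.onE e = Sum.inl t) ∧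
        (cover hf v H).total.src e = (Sum.inr q, s') ∧
        (cover hf v H).total.tgt e = (Sum.inl x, s)} ≃ Fin (D.hx x q).natAbs :=
      { toFun := fun e => match e with
          | ⟨(Sum.inl ⟨(x', q'), i⟩, s''), he⟩ => Fin.cast (by
              have h1 : q' = q := Sum.inr.inj (congrArg Prod.fst he.2.1)
              have h2 : x' = x := Sum.inl.inj (congrArg Prod.fst he.2.2)
              rw [h1, h2]) i
          | ⟨(Sum.inr o, s''), he⟩ => False.elim (by
              obtain ⟨t, ht⟩ := he.1
              exact Sum.inr_ne_inl ht)
        invFun := fun i => ⟨(Sum.inl ⟨(x, q), i⟩, s'), ⟨⟨_, rfl⟩, rfl, Prod.ext rfl (by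
          change (Λ.edge x q)⁻¹ • s' = s
          rw [h, inv_smul_smul])⟩⟩
        left_inv := by
          rintro ⟨⟨⟨⟨x', q'⟩, i⟩ | o, s''⟩, he⟩
          · obtain rfl : q' = q := Sum.inr.inj (congrArg Prod.fst he.2.1)
            obtain rfl : x' = x := Sum.inl.inj (congrArg Prod.fst he.2.2)
            obtain rfl : s'' = s' := congrArg Prod.snd he.2.1
            rfl
          · obtain ⟨t, ht⟩ := he.1
            exact absurd ht Sum.inr_ne_inl
        right_inv := fun i => rfl }
    rw [if_pos h, Nat.card_congr e, Nat.card_fin, Int.sign_mul_natAbs]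
  · rw [if_neg h]
    have : IsEmpty {e : (cover hf v H).total.E //
        (∃ t : D.TEdge, (cover hf v H).p.onE e = Sum.inl t) ∧
        (cover hf v H).total.src e = (Sum.inr q, s') ∧
        (cover hf v H).total.tgt e = (Sum.inl x, s)} := by
      refine ⟨?_⟩
      rintro ⟨⟨⟨⟨x', q'⟩, i⟩ | o, s''⟩, he⟩
      · obtain rfl : q' = q := Sum.inr.inj (congrArg Prod.fst he.2.1)
        obtain rfl : x' = x := Sum.inl.inj (congrArg Prod.fst he.2.2)
        obtain rfl : s'' = s' := congrArg Prod.snd he.2.1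
        have h1 : (Λ.edge x' q')⁻¹ • s'' = s := congrArg Prod.snd he.2.2
        exact h (by rw [← h1, smul_inv_smul])
      · obtain ⟨t, ht⟩ := he.1
        exact absurd ht Sum.inr_ne_inl
    rw [Nat.card_of_isEmpty, Nat.cast_zero, mul_zero]

/-- The sheet of a lift of a `Z`-check, read off in the trivialization. -/
def zSheet (z : Z) : (Quot fun a b : OverHandle (cover hf v H) z =>
    ∃ e : (cover hf v H).total.E, (cover hf v H).p.onE e ∈ Set.range (R.inclE z) ∧
      (cover hf v H).total.src e = a.1 ∧ (cover hf v H).total.tgt e = b.1) → Γ ⧸ H :=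
  Quot.lift (fun a => Λ.triv z a.1.1 • a.1.2) (by
    rintro ⟨⟨a, s⟩, ha⟩ ⟨⟨b, s'⟩, hb⟩ ⟨⟨e, s''⟩, ⟨e', he⟩, h1, h2⟩
    obtain rfl : R.inclE z e' = e := he
    have h3 : s'' = s := congrArg Prod.snd h1
    have h4 : (R.label Λ (R.inclE z e'))⁻¹ • s'' = s' := congrArg Prod.snd h2
    have h5 : R.complex.src (R.inclE z e') = a := congrArg Prod.fst h1
    have h6 : R.complex.tgt (R.inclE z e') = b := congrArg Prod.fst h2
    have h7 : ((R.handle z).graph.src e').1 = a := by rw [← h5]; rcases e' with _ | _ <;> rfl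
    have h8 : ((R.handle z).graph.tgt e').1 = b := by rw [← h6]; rcases e' with _ | _ <;> rfl
    change Λ.triv z a • s = Λ.triv z b • s'
    rw [← h4, label_inclE, h7, h8, h3, smul_smul]
    simp)

/-- Since the handle is connected, any vertex over it can be moved within its component to lie over
any prescribed vertex of the handle; there the invariant determines the sheet. -/
theorem zSheet_injective (z : Z) : Function.Injective (zSheet hf v H z) := by
  have key : ∀ (l : List (R.handle z).graph.Dart) (a b : (R.handle z).graph.V) (s : Γ ⧸ H),
      (R.handle z).graph.IsWalk a b l → ∃ s',
        (Quot.mk _ ⟨(a.1, s), a.2⟩ : Quot fun a b : OverHandle (cover hf v H) z =>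
          ∃ e : (cover hf v H).total.E, (cover hf v H).p.onE e ∈ Set.range (R.inclE z) ∧
            (cover hf v H).total.src e = a.1 ∧ (cover hf v H).total.tgt e = b.1) =
        Quot.mk _ ⟨(b.1, s'), b.2⟩ := by
    intro l
    induction l with
    | nil =>
      rintro a b s rfl
      exact ⟨s, rfl⟩
    | cons d l ih =>
      rintro a b s ⟨rfl, h2⟩
      have hs : ∀ e, R.complex.src (R.inclE z e) = ((R.handle z).graph.src e).1 := by
        rintro (_ | _) <;> rfl
      have ht : ∀ e, R.complex.tgt (R.inclE z e) = ((R.handle z).graph.tgt e).1 := by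
        rintro (_ | _) <;> rfl
      rcases d with ⟨e, _ | _⟩
      · obtain ⟨s', hs'⟩ := ih _ b (R.label Λ (R.inclE z e) • s) h2
        refine ⟨s', Eq.trans (Quot.sound ?_).symm hs'⟩
        exact ⟨(R.inclE z e, R.label Λ (R.inclE z e) • s), ⟨e, rfl⟩, Prod.ext (hs e) rfl,
          Prod.ext (ht e) (inv_smul_smul _ _)⟩
      · obtain ⟨s', hs'⟩ := ih _ b ((R.label Λ (R.inclE z e))⁻¹ • s) h2
        refine ⟨s', Eq.trans (Quot.sound ?_) hs'⟩
        exact ⟨(R.inclE z e, s), ⟨e, rfl⟩, Prod.ext (hs e) rfl, Prod.ext (ht e) rfl⟩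
  rintro ⟨⟨⟨a, s⟩, ha⟩⟩ ⟨⟨⟨b, s'⟩, hb⟩⟩ h
  obtain ⟨l, hl⟩ := handle_preconnected R z ⟨a, ha⟩ ⟨b, hb⟩
  obtain ⟨s'', h1⟩ := key l _ _ s hl
  refine Eq.trans h1 ?_
  have h2 := congrArg (zSheet hf v H z) h1
  have h3 : Λ.triv z b • s' = Λ.triv z b • s'' := h.symm.trans h2
  rw [smul_left_cancel _ h3]

theorem mem_cover_iff (σ : ZCell (cover hf v H)) (a : X ⊕ Q) (s : Γ ⧸ H) :
    ZCell.Mem (cover hf v H) σ (a, s) ↔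
      D.InT σ.1 a ∧ Λ.triv σ.1 a • s = zSheet hf v H σ.1 σ.2 := by
  constructor
  · rintro ⟨h, h1⟩
    exact ⟨h, by rw [← h1]; rfl⟩
  · rintro ⟨h, h1⟩
    exact ⟨h, zSheet_injective hf v H σ.1 h1⟩

/-- The lifts of the `Z`-checks to a coset covering. -/
noncomputable def zCellEquiv (hne : ∀ z, ∃ a, D.InT z a) :
    ZCell (cover hf v H) ≃ Z × (Γ ⧸ H) :=
  (Equiv.sigmaCongrRight fun z => Equiv.ofBijective (zSheet hf v H z)
    ⟨zSheet_injective hf v H z, fun s => by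
      obtain ⟨a, ha⟩ := hne z
      exact ⟨Quot.mk _ ⟨(a, (Λ.triv z a)⁻¹ • s), ha⟩, smul_inv_smul _ _⟩⟩).trans
    (Equiv.sigmaEquivProd _ _)

open Classical in
theorem liftZ_cover (σ : ZCell (cover hf v H)) (q : Q) (s : Γ ⧸ H) :
    liftZ (cover hf v H) σ ⟨q, (Sum.inr q, s), rfl⟩ =
      if Λ.triv σ.1 (Sum.inr q) • s = zSheet hf v H σ.1 σ.2 then D.hz σ.1 q else 0 := by
  unfold liftZ
  by_cases hm : ZCell.Mem (cover hf v H) σ (Sum.inr q, s)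
  · exact (if_pos hm).trans (if_pos ((mem_cover_iff hf v H σ _ s).1 hm).2).symm
  · refine (if_neg hm).trans ?_
    split_ifs with h
    · by_contra h0
      exact hm ((mem_cover_iff hf v H σ _ s).2 ⟨Ne.symm h0, h⟩)
    · rfl

/-- Over a fixed pair of cells, the product of the lifted integral matrices is either zero or an
entry of the product for the original `ℤ`-lift, which vanishes. Reduction mod 2 comes last. -/
theorem cover_orth [Fintype (QCell (cover hf v H))] :
    codeX (cover hf v H) * (codeZ (cover hf v H))ᵀ = 0 := by
  classical
  ext ⟨x, ⟨⟨a, s⟩, ha⟩⟩ σ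
  obtain rfl : a = Sum.inl x := ha
  have key : ∑ q, liftX (cover hf v H) ⟨x, ⟨(Sum.inl x, s), rfl⟩⟩ q *
      liftZ (cover hf v H) σ q = 0 := by
    -- The row of `(x, s)` is supported on one lift of each qubit, the one on sheet `Λ.edge x q •
    -- s`.
    let ι : Q → QCell (cover hf v H) := fun q => ⟨q, (Sum.inr q, Λ.edge x q • s), rfl⟩
    have hι : Function.Injective ι := fun q q' h => congrArg Sigma.fst h
    have h1 : ∑ q, liftX (cover hf v H) ⟨x, ⟨(Sum.inl x, s), rfl⟩⟩ (ι q) *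
        liftZ (cover hf v H) σ (ι q) = ∑ q, liftX (cover hf v H) ⟨x, ⟨(Sum.inl x, s), rfl⟩⟩ q *
      liftZ (cover hf v H) σ q := by
      refine Finset.sum_of_injOn ι hι.injOn (fun _ _ => Finset.mem_coe.2 (Finset.mem_univ _))
        ?_ fun _ _ => rfl
      rintro ⟨q, ⟨⟨b, s'⟩, hb⟩⟩ - hq
      obtain rfl : b = Sum.inr q := hb
      rw [liftX_cover, if_neg, zero_mul]
      rintro rfl
      exact hq ⟨q, Finset.mem_coe.2 (Finset.mem_univ _), rfl⟩
    rw [← h1]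
    have h2 : ∀ q, liftX (cover hf v H) ⟨x, ⟨(Sum.inl x, s), rfl⟩⟩ (ι q) *
        liftZ (cover hf v H) σ (ι q) =
        (if Λ.triv σ.1 (Sum.inl x) • s = zSheet hf v H σ.1 σ.2 then 1 else 0) *
          (D.hx x q * D.hz σ.1 q) := by
      intro q
      rw [liftX_cover, liftZ_cover, if_pos rfl]
      by_cases hx : D.hx x q = 0
      · simp [hx]
      by_cases hz : D.hz σ.1 q = 0
      · simp [hz]
      -- The trivialization moves the incidence condition from `q` to `x`, where it no longer
      -- depends on the qubit and can be pulled out of the sum.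
      rw [Λ.edge_eq x q σ.1 hx hz, smul_smul, mul_inv_cancel_left]
      split_ifs <;> simp
    rw [Finset.sum_congr rfl fun q _ => h2 q, ← Finset.mul_sum]
    have h3 := congrFun (congrFun D.orth x) σ.1
    rw [Matrix.mul_apply] at h3
    simp only [Matrix.transpose_apply] at h3
    rw [h3]
    exact mul_zero _
  have h4 := congrArg (Int.cast : ℤ → ZMod 2) key
  rw [Int.cast_sum] at h4
  rw [Matrix.mul_apply]
  refine Eq.trans (Finset.sum_congr rfl fun q _ => ?_) (h4.trans Int.cast_zero)
  exact (Int.cast_mul _ _).symm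

end CosetCover

/-- The matrices depend only on `Λ` and the cosets. The lifts of `z` are matched by their sheet in
the trivialization, for which each `z` must have a nonempty subgraph. -/
theorem sameLift_cover {R R' : Realization D} (hne : ∀ z, ∃ a, D.InT z a)
    (hf : R.complex.IsFull (R.label Λ)) (hf' : R'.complex.IsFull (R'.label Λ)) (v : X ⊕ Q)
    (H : Subgroup Γ) : SameLift (cover hf v H) (cover hf' v H) := by
  let eZ := (zCellEquiv hf v H hne).trans (zCellEquiv hf' v H hne).symm
  have h1 : ∀ σ, (eZ σ).1 = σ.1 ∧
      zSheet hf' v H _ (eZ σ).2 = zSheet hf v H _ σ.2 := by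
    intro σ
    have h := (zCellEquiv hf' v H hne).apply_symm_apply (zCellEquiv hf v H hne σ)
    exact ⟨congrArg Prod.fst h, congrArg Prod.snd h⟩
  refine ⟨Equiv.refl (XCell (cover hf v H)), Equiv.refl (QCell (cover hf v H)), eZ,
    fun _ => rfl, fun _ => rfl, fun σ => (h1 σ).1, ?_, ?_, ?_⟩
  · rintro (a | a) h <;> exact h
  · rintro ⟨x, ⟨⟨a, s⟩, ha⟩⟩ ⟨q, ⟨⟨b, s'⟩, hb⟩⟩
    obtain rfl : a = Sum.inl x := ha
    obtain rfl : b = Sum.inr q := hb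
    refine congrArg (Int.cast : ℤ → ZMod 2) ?_
    exact (liftX_cover hf' v H x q s s').trans (liftX_cover hf v H x q s s').symm
  · rintro σ ⟨q, ⟨⟨b, s⟩, hb⟩⟩
    obtain rfl : b = Sum.inr q := hb
    refine congrArg (Int.cast : ℤ → ZMod 2) ?_
    refine (liftZ_cover hf' v H (eZ σ) q s).trans (Eq.trans ?_ (liftZ_cover hf v H σ q s).symm)
    rw [(h1 σ).2, (h1 σ).1]

/-- The bijections induce maps `φ a` between the sheets over each vertex `a`. The matrices force
these maps to commute with transport along all edges, including the `Z`-type 1-cells, so what fixes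
the base sheet of one covering fixes that of the other. The hypotheses mod 2 ensure that no
incidence is lost in the binary matrices. -/
theorem SameLift.le {R R' : Realization D}
    (hx2 : ∀ x q, D.hx x q ≠ 0 → ((D.hx x q : ℤ) : ZMod 2) ≠ 0)
    (hz2 : ∀ z q, D.hz z q ≠ 0 → ((D.hz z q : ℤ) : ZMod 2) ≠ 0)
    (hf : R.complex.IsFull (R.label Λ)) (hf' : R'.complex.IsFull (R'.label Λ)) {v : X ⊕ Q}
    {H H' : Subgroup Γ} (h : SameLift (cover hf v H) (cover hf' v H')) : H ≤ H' := by
  classical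
  obtain ⟨eX, eQ, eZ, hX, hQ, hZ, hpt, hcX, hcZ⟩ := h
  let φ : X ⊕ Q → Γ ⧸ H → Γ ⧸ H' := fun a s => match a with
    | Sum.inl x => (eX ⟨x, (Sum.inl x, s), rfl⟩).2.1.2
    | Sum.inr q => (eQ ⟨q, (Sum.inr q, s), rfl⟩).2.1.2
  have hφX : ∀ x s, eX ⟨x, (Sum.inl x, s), rfl⟩ = ⟨x, (Sum.inl x, φ (Sum.inl x) s), rfl⟩ := by
    intro x s
    have h1 := hX ⟨x, (Sum.inl x, s), rfl⟩
    change _ = (⟨x, (Sum.inl x, (eX ⟨x, (Sum.inl x, s), rfl⟩).2.1.2), rfl⟩ :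
      XCell (cover hf' v H'))
    generalize eX ⟨x, (Sum.inl x, s), rfl⟩ = y at h1 ⊢
    obtain ⟨x', ⟨⟨a, s'⟩, ha⟩⟩ := y
    obtain rfl : x' = x := h1
    obtain rfl : a = Sum.inl x' := ha
    rfl
  have hφQ : ∀ q s, eQ ⟨q, (Sum.inr q, s), rfl⟩ = ⟨q, (Sum.inr q, φ (Sum.inr q) s), rfl⟩ := by
    intro q s
    have h1 := hQ ⟨q, (Sum.inr q, s), rfl⟩
    change _ = (⟨q, (Sum.inr q, (eQ ⟨q, (Sum.inr q, s), rfl⟩).2.1.2), rfl⟩ :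
      QCell (cover hf' v H'))
    generalize eQ ⟨q, (Sum.inr q, s), rfl⟩ = y at h1 ⊢
    obtain ⟨q', ⟨⟨a, s'⟩, ha⟩⟩ := y
    obtain rfl : q' = q := h1
    obtain rfl : a = Sum.inr q' := ha
    rfl
  -- If the images were not incident, a nonzero entry of `codeX` would be carried to zero.
  have hadj : ∀ x q s, D.hx x q ≠ 0 →
      φ (Sum.inr q) (Λ.edge x q • s) = Λ.edge x q • φ (Sum.inl x) s := by
    intro x q s h0
    by_contra hne
    have h1 := hcX ⟨x, (Sum.inl x, s), rfl⟩ ⟨q, (Sum.inr q, Λ.edge x q • s), rfl⟩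
    rw [hφX, hφQ] at h1
    simp only [codeX, Matrix.map_apply] at h1
    rw [liftX_cover, liftX_cover, if_pos rfl, if_neg hne, Int.cast_zero] at h1
    exact hx2 x q h0 h1.symm
  have hzq : ∀ z q (σ : ZCell (cover hf v H)) s, σ.1 = z → D.hz z q ≠ 0 →
      Λ.triv z (Sum.inr q) • s = zSheet hf v H σ.1 σ.2 →
      Λ.triv z (Sum.inr q) • φ (Sum.inr q) s = zSheet hf' v H' (eZ σ).1 (eZ σ).2 := by
    rintro _ q σ s rfl h0 hs
    by_contra hne
    have h1 := hcZ σ ⟨q, (Sum.inr q, s), rfl⟩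
    rw [hφQ] at h1
    simp only [codeZ, Matrix.map_apply] at h1
    rw [liftZ_cover, liftZ_cover, if_pos hs,
      if_neg fun h => hne ((congrArg (Λ.triv · _ • _) (hZ σ)).symm.trans h), Int.cast_zero] at h1
    exact hz2 _ q h0 h1.symm
  -- The matrices record only the qubits of a `Z`-check; an `X`-check of its subgraph is reached
  -- through a neighbouring qubit in the support.
  have hza : ∀ z a (σ : ZCell (cover hf v H)) s, σ.1 = z → D.InT z a →
      Λ.triv z a • s = zSheet hf v H σ.1 σ.2 →
      Λ.triv z a • φ a s = zSheet hf' v H' (eZ σ).1 (eZ σ).2 := by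
    rintro z (x | q) σ s h1 h0 hs
    · obtain ⟨q, hq, hxq⟩ := h0
      have he := Λ.edge_eq x q z hxq hq
      have h2 : Λ.triv z (Sum.inl x) = Λ.triv z (Sum.inr q) * Λ.edge x q := by
        rw [he, mul_inv_cancel_left]
      rw [h2, mul_smul] at hs ⊢
      rw [← hadj x q s hxq]
      exact hzq z q σ _ h1 hq hs
    · exact hzq z q σ s h1 h0 hs
  have hzz : ∀ z a b s s', D.InT z a → D.InT z b → Λ.triv z a • s = Λ.triv z b • s' →
      Λ.triv z a • φ a s = Λ.triv z b • φ b s' := by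
    intro z a b s s' ha hb hs
    let σ : ZCell (cover hf v H) := ⟨z, Quot.mk _ ⟨(a, s), ha⟩⟩
    rw [hza z a σ s rfl ha rfl, hza z b σ s' rfl hb hs.symm]
  -- A 1-cell is invisible in the matrices, but its lifted ends lie in the same lift of `z`, which
  -- is preserved by `hzz`.
  have hedge : ∀ e s, φ (R.complex.src e) (R.label Λ e • s) =
      R.label Λ e • φ (R.complex.tgt e) s := by
    rintro (t | ⟨z, e⟩) s
    · exact hadj _ _ s t.hx_ne_zero
    · have h1 := hzz z (D.proj z ((R.handle z).fst e)) (D.proj z ((R.handle z).snd e))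
        (R.label Λ (Sum.inr ⟨z, e⟩) • s) s (D.inT_proj z _) (D.inT_proj z _)
        (by simp [label, mul_smul])
      change φ (D.proj z ((R.handle z).fst e)) _ = (_ * _) • φ (D.proj z ((R.handle z).snd e)) s
      rw [mul_smul, ← h1, inv_smul_smul]
  have hwalk : ∀ l a b s, R.complex.IsWalk a b l →
      φ a (walkLabel (R.label Λ) l • s) = walkLabel (R.label Λ) l • φ b s := by
    intro l
    induction l with
    | nil =>
      rintro a b s rfl
      simp
    | cons d l ih =>
      rintro a b s ⟨rfl, h2⟩
      rw [walkLabel_cons, mul_smul, mul_smul, ← ih _ b s h2]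
      generalize walkLabel (R.label Λ) l • s = s'
      rcases d with ⟨e, _ | _⟩
      · have h3 := hedge e ((R.label Λ e)⁻¹ • s')
        rw [smul_inv_smul] at h3
        exact (inv_smul_eq_iff.2 h3).symm
      · exact hedge e s'
  have hφ1 : φ v ((1 : Γ) : Γ ⧸ H) = ((1 : Γ) : Γ ⧸ H') := by
    rcases v with x | q
    · exact congrArg Prod.snd (hpt (Sum.inl ⟨x, (Sum.inl x, ((1 : Γ) : Γ ⧸ H)), rfl⟩) rfl)
    · exact congrArg Prod.snd (hpt (Sum.inr ⟨q, (Sum.inr q, ((1 : Γ) : Γ ⧸ H)), rfl⟩) rfl)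
  intro g hg
  obtain ⟨l, hl, rfl⟩ := hf v v g
  have h1 := hwalk l v v ((1 : Γ) : Γ ⧸ H) hl
  have h2 : walkLabel (R.label Λ) l • ((1 : Γ) : Γ ⧸ H) = ((1 : Γ) : Γ ⧸ H) := by
    rw [MulAction.Quotient.smul_coe, smul_eq_mul, mul_one]
    exact (QuotientGroup.eq.2 (by simpa using hg)).symm
  rw [h2, hφ1, MulAction.Quotient.smul_coe, smul_eq_mul, mul_one] at h1
  simpa using QuotientGroup.eq.1 h1

end Realization

/-! ### Flat labels on simply connected complexes and on products -/

namespace TwoComplex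

/-- On a simply connected complex every flat label is a difference of values of a function on the
vertices. -/
theorem SimplyConnected.exists_triv {L : TwoComplex.{u}} (hL : L.SimplyConnected) {Γ : Type*}
    [Group Γ] {m : L.E → Γ} (hm : L.IsFlat m) :
    ∃ h : L.V → Γ, ∀ e, m e = (h (L.src e))⁻¹ * h (L.tgt e) := by
  by_cases hV : Nonempty L.V
  · obtain ⟨a⟩ := hV
    choose l hl using hL.1 a
    -- The potential at `b` is the label of a chosen path from `a`; the loop through `e` has trivial
    -- label.
    refine ⟨fun b => walkLabel m (l b), fun e => ?_⟩
    let γ : ∀ b, L.Walk a b := fun b => ⟨l b, hl b⟩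
    have h1 : walkLabel m (l (L.src e) ++ [(e, true)] ++ L.revWalk (l (L.tgt e))) = 1 :=
      hm.homotopic (hL.2 a (((γ (L.src e)).append (Walk.single (e, true))).append
        (γ (L.tgt e)).rev))
    rw [walkLabel_append, walkLabel_append, MultiGraph.walkLabel_revWalk, mul_inv_eq_one] at h1
    dsimp only
    rw [← h1]
    simp [dartLabel]
  · exact ⟨fun _ => 1, fun e => (hV ⟨L.src e⟩).elim⟩

theorem isFull_tautLabel {L : TwoComplex.{u}} {v : L.V} (η : ∀ a, L.Walk v a) :
    L.IsFull (tautLabel η) := by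
  intro a b g
  let w : L.Walk a b := (η a).rev.append (η b)
  obtain ⟨w', hw'⟩ := tautLabel_surjective η a (g * (walkLabel (tautLabel η) w.1)⁻¹)
  refine ⟨_, (w'.append w).2, ?_⟩
  change walkLabel _ (w'.1 ++ w.1) = g
  rw [walkLabel_append, hw', inv_mul_cancel_right]

/-- This is the computation of `π₁` of a product in terms of labels: `f₁ w` labels the slice `T₁ ×
{w}` and `f₂ a` the slice `{a} × T₂`. Commutation on squares extends to rectangles of paths, so the
loops of the two base slices have commuting labels and define `Ψ`. The gauge `h a c` is the label of
the path along `γ₁ a` and then `γ₂ c`; it identifies the given label with the image under `Ψ` of the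
tautological one. -/
theorem exists_hom_of_squares {T₁ T₂ : TwoComplex.{u}} {t₁ : T₁.V} {t₂ : T₂.V}
    (γ₁ : ∀ a, T₁.Walk t₁ a) (γ₂ : ∀ a, T₂.Walk t₂ a) {Γ : Type*} [Group Γ]
    (f₁ : T₂.V → T₁.E → Γ) (f₂ : T₁.V → T₂.E → Γ) (h₁ : ∀ w, T₁.IsFlat (f₁ w))
    (h₂ : ∀ w, T₂.IsFlat (f₂ w))
    (hsq : ∀ e₁ e₂, f₁ (T₂.src e₂) e₁ * f₂ (T₁.tgt e₁) e₂ =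
      f₂ (T₁.src e₁) e₂ * f₁ (T₂.tgt e₂) e₁) :
    ∃ (Ψ : T₁.Pi1 t₁ × T₂.Pi1 t₂ →* Γ) (h : T₁.V → T₂.V → Γ),
      (∀ e w, h (T₁.src e) w * f₁ w e = Ψ (tautLabel γ₁ e, 1) * h (T₁.tgt e) w) ∧
      (∀ a e, h a (T₂.src e) * f₂ a e = Ψ (1, tautLabel γ₂ e) * h a (T₂.tgt e)) := by
  have hdart : ∀ (d₁ : T₁.Dart) (d₂ : T₂.Dart),
      dartLabel (f₁ (T₂.dsrc d₂)) d₁ * dartLabel (f₂ (T₁.dtgt d₁)) d₂ =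
        dartLabel (f₂ (T₁.dsrc d₁)) d₂ * dartLabel (f₁ (T₂.dtgt d₂)) d₁ := by
    rintro ⟨e₁, _ | _⟩ ⟨e₂, _ | _⟩ <;>
      simp only [dartLabel, MultiGraph.dsrc, MultiGraph.dtgt, if_true, Bool.false_eq_true,
        if_false] <;>
      rw [eq_mul_inv_of_mul_eq (hsq e₁ e₂)] <;> group
  have hrow : ∀ (d₁ : T₁.Dart) (l₂ : List T₂.Dart) (c d : T₂.V), T₂.IsWalk c d l₂ →
      dartLabel (f₁ c) d₁ * walkLabel (f₂ (T₁.dtgt d₁)) l₂ =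
        walkLabel (f₂ (T₁.dsrc d₁)) l₂ * dartLabel (f₁ d) d₁ := by
    intro d₁ l₂
    induction l₂ with
    | nil =>
      rintro c d rfl
      simp
    | cons d₂ l₂ ih =>
      rintro c d ⟨rfl, h⟩
      rw [walkLabel_cons, walkLabel_cons, ← mul_assoc, hdart, mul_assoc, ih _ _ h, mul_assoc]
  have hwalk : ∀ (l₁ : List T₁.Dart) (l₂ : List T₂.Dart) (a b : T₁.V) (c d : T₂.V),
      T₁.IsWalk a b l₁ → T₂.IsWalk c d l₂ →
      walkLabel (f₁ c) l₁ * walkLabel (f₂ b) l₂ = walkLabel (f₂ a) l₂ * walkLabel (f₁ d) l₁ := by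
    intro l₁ l₂
    induction l₁ with
    | nil =>
      rintro a b c d rfl -
      simp
    | cons d₁ l₁ ih =>
      rintro a b c d ⟨rfl, h⟩ h'
      rw [walkLabel_cons, walkLabel_cons, mul_assoc, ih _ _ _ _ h h', ← mul_assoc,
        hrow d₁ l₂ c d h', mul_assoc]
  let Ψ : T₁.Pi1 t₁ × T₂.Pi1 t₂ →* Γ :=
    ((h₁ t₂).hom t₁).noncommCoprod ((h₂ t₁).hom t₂) (by
      rintro ⟨w₁⟩ ⟨w₂⟩
      exact hwalk _ _ _ _ _ _ w₁.2 w₂.2)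
  have hΨ₁ : ∀ e, Ψ (tautLabel γ₁ e, 1) = walkLabel (f₁ t₂) (γ₁ (T₁.src e)).1 * f₁ t₂ e *
      (walkLabel (f₁ t₂) (γ₁ (T₁.tgt e)).1)⁻¹ := by
    intro e
    have h : Ψ (tautLabel γ₁ e, 1) = walkLabel (f₁ t₂)
        ((γ₁ (T₁.src e)).1 ++ [(e, true)] ++ T₁.revWalk (γ₁ (T₁.tgt e)).1) * 1 := rfl
    rw [h, walkLabel_append, walkLabel_append, MultiGraph.walkLabel_revWalk]
    simp [dartLabel]
  have hΨ₂ : ∀ e, Ψ (1, tautLabel γ₂ e) = walkLabel (f₂ t₁)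
        ((γ₂ (T₂.src e)).1 ++ [(e, true)] ++ T₂.revWalk (γ₂ (T₂.tgt e)).1) := fun e =>
    one_mul (walkLabel (f₂ t₁)
      ((γ₂ (T₂.src e)).1 ++ [(e, true)] ++ T₂.revWalk (γ₂ (T₂.tgt e)).1))
  refine ⟨Ψ, fun a c => walkLabel (f₁ t₂) (γ₁ a).1 * walkLabel (f₂ a) (γ₂ c).1,
    fun e w => ?_, fun a e => ?_⟩
  · have h := hrow (e, true) _ _ _ (γ₂ w).2
    simp only [dartLabel, MultiGraph.dsrc, MultiGraph.dtgt, if_true] at h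
    rw [hΨ₁, mul_assoc, ← h]
    group
  · have h := hwalk _ _ _ _ _ _ (γ₁ a).2
      (((γ₂ (T₂.src e)).append (Walk.single (e, true))).append (γ₂ (T₂.tgt e)).rev).2
    change walkLabel (f₁ t₂) (γ₁ a).1 * walkLabel (f₂ a)
        ((γ₂ (T₂.src e)).1 ++ [(e, true)] ++ T₂.revWalk (γ₂ (T₂.tgt e)).1) =
      walkLabel (f₂ t₁) ((γ₂ (T₂.src e)).1 ++ [(e, true)] ++ T₂.revWalk (γ₂ (T₂.tgt e)).1) *
        walkLabel (f₁ t₂) (γ₁ a).1 at h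
    rw [hΨ₂, ← mul_assoc, ← h]
    simp [MultiGraph.walkLabel_revWalk, dartLabel, mul_assoc]

end TwoComplex

/-! ### Trivializations over handles and labels of paths in a realization -/

namespace Realization

section Generic

variable {X Q Z : Type u} [Fintype Q] {C : CSSCode X Q Z} {D : ZLift C} {Γ : Type u} [Group Γ]
  {Λ : D.Label Γ} {R : Realization D}

theorem exists_triv {m : R.complex.E → Γ} (hm : R.complex.IsFlat m) :
    ∃ μ : Z → X ⊕ Q → Γ, ∀ z e, m (R.inclE z e) =
      (μ z ((R.handle z).graph.src e).1)⁻¹ * μ z ((R.handle z).graph.tgt e).1 := by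
  classical
  have h : ∀ z, ∃ h : (R.handle z).graph.V → Γ, ∀ e, m (R.inclE z e) =
      (h ((R.handle z).graph.src e))⁻¹ * h ((R.handle z).graph.tgt e) := by
    intro z
    refine (R.handle z).simplyConnected.exists_triv (m := fun e => m (R.inclE z e)) fun f => ?_
    have h1 := hm ⟨z, f⟩
    rw [walkLabel, List.map_map] at h1
    exact h1
  choose h hh using h
  -- Only the values on the subgraph of `z` matter; the value 1 elsewhere is arbitrary.
  refine ⟨fun z a => if ha : D.InT z a then h z ⟨a, ha⟩ else 1, fun z e => ?_⟩
  dsimp only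
  rw [hh, dif_pos ((R.handle z).graph.src e).2, dif_pos ((R.handle z).graph.tgt e).2]
  rfl

variable (Λ R) in
/-- There is an edge path from `v` to `a` with label `g`. -/
def Reach (v a : X ⊕ Q) (g : Γ) : Prop :=
  ∃ l, R.complex.IsWalk v a l ∧ walkLabel (R.label Λ) l = g

variable {v : X ⊕ Q} {g : Γ}

theorem Reach.edge {t : D.TEdge} (h : Reach Λ R v (Sum.inr t.1.2) g) :
    Reach Λ R v (Sum.inl t.1.1) (g * Λ.edge t.1.1 t.1.2) := by
  obtain ⟨l, hl, rfl⟩ := h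
  exact ⟨l ++ [(Sum.inl t, true)], hl.append ⟨rfl, rfl⟩, by simp [dartLabel, label]⟩

theorem Reach.edge_inv {t : D.TEdge} (h : Reach Λ R v (Sum.inl t.1.1) g) :
    Reach Λ R v (Sum.inr t.1.2) (g * (Λ.edge t.1.1 t.1.2)⁻¹) := by
  obtain ⟨l, hl, rfl⟩ := h
  exact ⟨l ++ [(Sum.inl t, false)], hl.append ⟨rfl, rfl⟩, by simp [dartLabel, label]⟩

/-- All paths between two vertices inside a handle have the same label, given by the trivialization,
and at least one exists. -/
theorem Reach.handle {z : Z} {a b : X ⊕ Q} (ha : D.InT z a) (hb : D.InT z b)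
    (h : Reach Λ R v a g) : Reach Λ R v b (g * (Λ.triv z a)⁻¹ * Λ.triv z b) := by
  obtain ⟨l, hl, rfl⟩ := h
  obtain ⟨l', hl'⟩ := handle_preconnected R z ⟨a, ha⟩ ⟨b, hb⟩
  refine ⟨_, hl.append (R.isWalk_incl z hl'), ?_⟩
  rw [walkLabel_append, walkLabel_incl z hl', mul_assoc]

end Generic

/-! ### Hypergraph products -/

section HPC

variable {K₁ B₁ K₂ B₂ : Type u} [Fintype K₁] [Fintype B₁] [Fintype K₂] [Fintype B₂]
  [DecidableEq K₁] [DecidableEq B₁] [DecidableEq K₂] [DecidableEq B₂]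
  {H₁ : Matrix K₁ B₁ (ZMod 2)} {H₂ : Matrix K₂ B₂ (ZMod 2)}

theorem hx_inl (k₁ : K₁) (b₂ : B₂) (b₁ : B₁) (b₂' : B₂) :
    (hpcLift H₁ H₂).hx (k₁, b₂) (Sum.inl (b₁, b₂')) =
      if b₂ = b₂' ∧ H₁ k₁ b₁ ≠ 0 then 1 else 0 := by
  change (((H₁ k₁ b₁ * (1 : Matrix B₂ B₂ (ZMod 2)) b₂ b₂').val : ℕ) : ℤ) = _
  rw [Matrix.one_apply]
  generalize H₁ k₁ b₁ = a
  by_cases h : b₂ = b₂' <;> simp only [h, if_true, if_false] <;> revert a <;> decide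

theorem hx_inr (k₁ : K₁) (b₂ : B₂) (k₁' : K₁) (k₂ : K₂) :
    (hpcLift H₁ H₂).hx (k₁, b₂) (Sum.inr (k₁', k₂)) =
      if k₁ = k₁' ∧ H₂ k₂ b₂ ≠ 0 then 1 else 0 := by
  change ((((1 : Matrix K₁ K₁ (ZMod 2)) k₁ k₁' * H₂ k₂ b₂).val : ℕ) : ℤ) = _
  rw [Matrix.one_apply]
  generalize H₂ k₂ b₂ = a
  by_cases h : k₁ = k₁' <;> simp only [h, if_true, if_false] <;> revert a <;> decide

theorem hz_inl (b₁ : B₁) (k₂ : K₂) (b₁' : B₁) (b₂ : B₂) :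
    (hpcLift H₁ H₂).hz (b₁, k₂) (Sum.inl (b₁', b₂)) =
      if b₁ = b₁' ∧ H₂ k₂ b₂ ≠ 0 then 1 else 0 := by
  change ((((1 : Matrix B₁ B₁ (ZMod 2)) b₁ b₁' * H₂ k₂ b₂).val : ℕ) : ℤ) = _
  rw [Matrix.one_apply]
  generalize H₂ k₂ b₂ = a
  by_cases h : b₁ = b₁' <;> simp only [h, if_true, if_false] <;> revert a <;> decide

theorem hz_inr (b₁ : B₁) (k₂ : K₂) (k₁ : K₁) (k₂' : K₂) :
    (hpcLift H₁ H₂).hz (b₁, k₂) (Sum.inr (k₁, k₂')) =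
      if k₂ = k₂' ∧ H₁ k₁ b₁ ≠ 0 then -1 else 0 := by
  change -(((H₁ k₁ b₁ * (1 : Matrix K₂ K₂ (ZMod 2)) k₂ k₂').val : ℕ) : ℤ) = _
  rw [Matrix.one_apply]
  generalize H₁ k₁ b₁ = a
  by_cases h : k₂ = k₂' <;> simp only [h, if_true, if_false] <;> revert a <;> decide

theorem hx_inl_ne {k₁ : K₁} {b₂ : B₂} {b₁ : B₁} {b₂' : B₂} :
    (hpcLift H₁ H₂).hx (k₁, b₂) (Sum.inl (b₁, b₂')) ≠ 0 ↔ b₂ = b₂' ∧ H₁ k₁ b₁ ≠ 0 := by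
  rw [hx_inl]; split_ifs with h <;> simp [h]

theorem hx_inr_ne {k₁ : K₁} {b₂ : B₂} {k₁' : K₁} {k₂ : K₂} :
    (hpcLift H₁ H₂).hx (k₁, b₂) (Sum.inr (k₁', k₂)) ≠ 0 ↔ k₁ = k₁' ∧ H₂ k₂ b₂ ≠ 0 := by
  rw [hx_inr]; split_ifs with h <;> simp [h]

theorem hz_inl_ne {b₁ : B₁} {k₂ : K₂} {b₁' : B₁} {b₂ : B₂} :
    (hpcLift H₁ H₂).hz (b₁, k₂) (Sum.inl (b₁', b₂)) ≠ 0 ↔ b₁ = b₁' ∧ H₂ k₂ b₂ ≠ 0 := by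
  rw [hz_inl]; split_ifs with h <;> simp [h]

theorem hz_inr_ne {b₁ : B₁} {k₂ : K₂} {k₁ : K₁} {k₂' : K₂} :
    (hpcLift H₁ H₂).hz (b₁, k₂) (Sum.inr (k₁, k₂')) ≠ 0 ↔ k₂ = k₂' ∧ H₁ k₁ b₁ ≠ 0 := by
  rw [hz_inr]; split_ifs with h <;> simp [h]

theorem hpc_hx_eq_one {x : K₁ × B₂} {q : B₁ × B₂ ⊕ K₁ × K₂} (h : (hpcLift H₁ H₂).hx x q ≠ 0) :
    (hpcLift H₁ H₂).hx x q = 1 := by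
  obtain ⟨k₁, b₂⟩ := x
  rcases q with ⟨b₁, b₂'⟩ | ⟨k₁', k₂⟩
  · rw [hx_inl, if_pos (hx_inl_ne.1 h)]
  · rw [hx_inr, if_pos (hx_inr_ne.1 h)]

theorem hpc_hz_eq {z : B₁ × K₂} {q : B₁ × B₂ ⊕ K₁ × K₂} (h : (hpcLift H₁ H₂).hz z q ≠ 0) :
    (hpcLift H₁ H₂).hz z q = Sum.elim (fun _ => 1) (fun _ => -1) q := by
  obtain ⟨b₁, k₂⟩ := z
  rcases q with ⟨b₁', b₂⟩ | ⟨k₁, k₂'⟩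
  · rw [hz_inl, if_pos (hz_inl_ne.1 h)]; rfl
  · rw [hz_inr, if_pos (hz_inr_ne.1 h)]; rfl

/-- The edge of the lifted Tanner graph given by a nonzero entry. -/
def hpcEdge {x : K₁ × B₂} {q : B₁ × B₂ ⊕ K₁ × K₂} (h : (hpcLift H₁ H₂).hx x q ≠ 0) :
    (hpcLift H₁ H₂).TEdge := ⟨(x, q), ⟨0, Int.natAbs_pos.2 h⟩⟩

theorem hpcEdge_eq (t : (hpcLift H₁ H₂).TEdge) : t = hpcEdge t.hx_ne_zero := by
  obtain ⟨⟨x, q⟩, i⟩ := t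
  have h : (hpcLift H₁ H₂).hx x q ≠ 0 := ZLift.TEdge.hx_ne_zero ⟨(x, q), i⟩
  have h1 : ((hpcLift H₁ H₂).hx x q).natAbs = 1 := by rw [hpc_hx_eq_one h]; rfl
  refine congrArg (Sigma.mk (x, q)) (Fin.ext ?_)
  have := i.2
  dsimp only at this ⊢
  omega

variable {t₁ : (tannerGraph H₁).V} {t₂ : (tannerGraph H₂).V}

/-- The tautological label of a nonzero entry of a parity-check matrix. -/
def entryLabel {K B : Type u} {H : Matrix K B (ZMod 2)} {t : (tannerGraph H).V}
    (γ : ∀ a, (tannerGraph H).Walk t a) (k : K) (b : B) : (tannerGraph H).Pi1 t :=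
  -- No edge belongs to a zero entry, so the value 1 there is arbitrary.
  if h : H k b ≠ 0 then TwoComplex.tautLabel γ ⟨(k, b), h⟩ else 1

theorem entryLabel_eq {K B : Type u} {H : Matrix K B (ZMod 2)} {t : (tannerGraph H).V}
    (γ : ∀ a, (tannerGraph H).Walk t a) {k : K} {b : B} (h : H k b ≠ 0) :
    entryLabel γ k b = TwoComplex.tautLabel γ ⟨(k, b), h⟩ := dif_pos h

/-- The label of the realizations of a hypergraph product with values in the product of the
fundamental groups of the Tanner graphs. -/
def hpcLabel (γ₁ : ∀ a, (tannerGraph H₁).Walk t₁ a) (γ₂ : ∀ a, (tannerGraph H₂).Walk t₂ a) :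
    (hpcLift H₁ H₂).Label ((tannerGraph H₁).Pi1 t₁ × (tannerGraph H₂).Pi1 t₂) where
  edge x q := match q with
    | Sum.inl q => (entryLabel γ₁ x.1 q.1, 1)
    | Sum.inr q => (1, (entryLabel γ₂ q.2 x.2)⁻¹)
  -- This is the label of the shortest product path from the missing vertex `z` to `a`. Tanner edges
  -- run from bits to checks, so the second factor is traversed backwards and appears inverted.
  triv z a := match a with
    | Sum.inl x => (entryLabel γ₁ x.1 z.1, (entryLabel γ₂ z.2 x.2)⁻¹)
    | Sum.inr (Sum.inl q) => (1, (entryLabel γ₂ z.2 q.2)⁻¹)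
    | Sum.inr (Sum.inr q) => (entryLabel γ₁ q.1 z.1, 1)
  edge_eq := by
    rintro ⟨k₁, b₂⟩ (⟨b₁, b₂'⟩ | ⟨k₁', k₂⟩) ⟨b₁', k₂'⟩ hx hz
    · obtain ⟨rfl, -⟩ := hx_inl_ne.1 hx
      obtain ⟨rfl, -⟩ := hz_inl_ne.1 hz
      simp
    · obtain ⟨rfl, -⟩ := hx_inr_ne.1 hx
      obtain ⟨rfl, -⟩ := hz_inr_ne.1 hz
      simp

/-! ### Surjectivity: imitating paths of the product of the Tanner graphs -/

variable {γ₁ : ∀ a, (tannerGraph H₁).Walk t₁ a} {γ₂ : ∀ a, (tannerGraph H₂).Walk t₂ a}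

/-- The position of a vertex of a realization in the product of the Tanner graphs. -/
def coord : K₁ × B₂ ⊕ (B₁ × B₂ ⊕ K₁ × K₂) → (K₁ ⊕ B₁) × (K₂ ⊕ B₂)
  | Sum.inl x => (Sum.inl x.1, Sum.inr x.2)
  | Sum.inr (Sum.inl q) => (Sum.inr q.1, Sum.inr q.2)
  | Sum.inr (Sum.inr q) => (Sum.inl q.1, Sum.inl q.2)

variable (γ₁ γ₂) in
/-- `Reach` for the vertices of the product of the Tanner graphs; those which are not vertices of
the realization are the `Z`-checks. -/
def ProdReach (R : Realization (hpcLift H₁ H₂)) (v : K₁ × B₂ ⊕ (B₁ × B₂ ⊕ K₁ × K₂)) :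
    K₁ ⊕ B₁ → K₂ ⊕ B₂ → (tannerGraph H₁).Pi1 t₁ × (tannerGraph H₂).Pi1 t₂ → Prop
  | Sum.inl k₁, Sum.inr b₂, g => Reach (hpcLabel γ₁ γ₂) R v (Sum.inl (k₁, b₂)) g
  | Sum.inr b₁, Sum.inr b₂, g => Reach (hpcLabel γ₁ γ₂) R v (Sum.inr (Sum.inl (b₁, b₂))) g
  | Sum.inl k₁, Sum.inl k₂, g => Reach (hpcLabel γ₁ γ₂) R v (Sum.inr (Sum.inr (k₁, k₂))) g
  | Sum.inr b₁, Sum.inl k₂, g => ∀ a, (hpcLift H₁ H₂).InT (b₁, k₂) a →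
      Reach (hpcLabel γ₁ γ₂) R v a (g * (hpcLabel γ₁ γ₂).triv (b₁, k₂) a)

theorem prodReach_coord {R : Realization (hpcLift H₁ H₂)}
    {v a : K₁ × B₂ ⊕ (B₁ × B₂ ⊕ K₁ × K₂)}
    {g : (tannerGraph H₁).Pi1 t₁ × (tannerGraph H₂).Pi1 t₂} :
    ProdReach γ₁ γ₂ R v (coord a).1 (coord a).2 g ↔ Reach (hpcLabel γ₁ γ₂) R v a g := by
  rcases a with x | q | q <;> rfl

theorem Reach.prodReach {R : Realization (hpcLift H₁ H₂)}
    {v a : K₁ × B₂ ⊕ (B₁ × B₂ ⊕ K₁ × K₂)} {b₁ : B₁} {k₂ : K₂}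
    {g : (tannerGraph H₁).Pi1 t₁ × (tannerGraph H₂).Pi1 t₂}
    (h : Reach (hpcLabel γ₁ γ₂) R v a g) (ha : (hpcLift H₁ H₂).InT (b₁, k₂) a) :
    ProdReach γ₁ γ₂ R v (Sum.inr b₁) (Sum.inl k₂)
      (g * ((hpcLabel γ₁ γ₂).triv (b₁, k₂) a)⁻¹) :=
  fun _ hb => h.handle ha hb

/-- If the second coordinate is a bit, the step is an edge of the lifted Tanner graph. If it is a
check, the step enters or leaves a missing vertex and is made inside the handle. -/
theorem ProdReach.dart₁ {R : Realization (hpcLift H₁ H₂)} {v : K₁ × B₂ ⊕ (B₁ × B₂ ⊕ K₁ × K₂)}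
    {g : (tannerGraph H₁).Pi1 t₁ × (tannerGraph H₂).Pi1 t₂} (d : (tannerGraph H₁).Dart)
    (w : K₂ ⊕ B₂) (h : ProdReach γ₁ γ₂ R v ((tannerGraph H₁).dsrc d) w g) :
    ProdReach γ₁ γ₂ R v ((tannerGraph H₁).dtgt d) w
      (g * (dartLabel (TwoComplex.tautLabel γ₁) d, 1)) := by
  obtain ⟨⟨⟨k₁, b₁⟩, h0⟩, b⟩ := d
  have e := entryLabel_eq γ₁ h0
  rcases w with k₂ | b₂ <;> rcases b with _ | _
  · have h1 := Reach.prodReach (b₁ := b₁) h (hz_inr_ne.2 ⟨rfl, h0⟩)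
    simp only [hpcLabel, e, Prod.inv_mk, inv_one] at h1
    exact h1
  · have h1 := h (Sum.inr (Sum.inr (k₁, k₂))) (hz_inr_ne.2 ⟨rfl, h0⟩)
    simp only [hpcLabel, e] at h1
    exact h1
  · have h1 := Reach.edge_inv
      (t := hpcEdge (H₁ := H₁) (H₂ := H₂) (hx_inl_ne.2 ⟨rfl, h0⟩ :
        (hpcLift H₁ H₂).hx (k₁, b₂) (Sum.inl (b₁, b₂)) ≠ 0)) h
    simp only [hpcLabel, hpcEdge, e, Prod.inv_mk, inv_one] at h1
    exact h1
  · have h1 := Reach.edge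
      (t := hpcEdge (H₁ := H₁) (H₂ := H₂) (hx_inl_ne.2 ⟨rfl, h0⟩ :
        (hpcLift H₁ H₂).hx (k₁, b₂) (Sum.inl (b₁, b₂)) ≠ 0)) h
    simp only [hpcLabel, hpcEdge, e] at h1
    exact h1

theorem ProdReach.dart₂ {R : Realization (hpcLift H₁ H₂)} {v : K₁ × B₂ ⊕ (B₁ × B₂ ⊕ K₁ × K₂)}
    {g : (tannerGraph H₁).Pi1 t₁ × (tannerGraph H₂).Pi1 t₂} (d : (tannerGraph H₂).Dart)
    (w : K₁ ⊕ B₁) (h : ProdReach γ₁ γ₂ R v w ((tannerGraph H₂).dsrc d) g) :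
    ProdReach γ₁ γ₂ R v w ((tannerGraph H₂).dtgt d)
      (g * (1, dartLabel (TwoComplex.tautLabel γ₂) d)) := by
  obtain ⟨⟨⟨k₂, b₂⟩, h0⟩, b⟩ := d
  have e := entryLabel_eq γ₂ h0
  rcases w with k₁ | b₁ <;> rcases b with _ | _
  · have h1 := Reach.edge
      (t := hpcEdge (H₁ := H₁) (H₂ := H₂) (hx_inr_ne.2 ⟨rfl, h0⟩ :
        (hpcLift H₁ H₂).hx (k₁, b₂) (Sum.inr (k₁, k₂)) ≠ 0)) h
    simp only [hpcLabel, hpcEdge, e] at h1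
    exact h1
  · have h1 := Reach.edge_inv
      (t := hpcEdge (H₁ := H₁) (H₂ := H₂) (hx_inr_ne.2 ⟨rfl, h0⟩ :
        (hpcLift H₁ H₂).hx (k₁, b₂) (Sum.inr (k₁, k₂)) ≠ 0)) h
    simp only [hpcLabel, hpcEdge, e, Prod.inv_mk, inv_one, inv_inv] at h1
    exact h1
  · have h1 := h (Sum.inr (Sum.inl (b₁, b₂))) (hz_inl_ne.2 ⟨rfl, h0⟩)
    simp only [hpcLabel, e] at h1
    exact h1
  · have h1 := Reach.prodReach (k₂ := k₂) h (hz_inl_ne.2 ⟨rfl, h0⟩)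
    simp only [hpcLabel, e, Prod.inv_mk, inv_one, inv_inv] at h1
    exact h1

/-- A product path can be chosen with prescribed label in each factor, moving first in one
coordinate and then in the other; it is followed step by step through `ProdReach`. -/
theorem isFull_hpcLabel (γ₁ : ∀ a, (tannerGraph H₁).Walk t₁ a)
    (γ₂ : ∀ a, (tannerGraph H₂).Walk t₂ a) (R : Realization (hpcLift H₁ H₂)) :
    R.complex.IsFull (R.label (hpcLabel γ₁ γ₂)) := by
  have m₁ : ∀ x y, ((x, 1) : (tannerGraph H₁).Pi1 t₁ × (tannerGraph H₂).Pi1 t₂) * (y, 1) =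
      (x * y, 1) := fun x y => Prod.ext rfl (one_mul 1)
  have h₁ : ∀ v l a b w g, (tannerGraph H₁).IsWalk a b l → ProdReach γ₁ γ₂ R v a w g →
      ProdReach γ₁ γ₂ R v b w (g * (walkLabel (TwoComplex.tautLabel γ₁) l, 1)) := by
    intro v l
    induction l with
    | nil =>
      rintro a b w g rfl h
      exact (mul_one g).symm ▸ h
    | cons d l ih =>
      rintro a b w g ⟨rfl, h'⟩ h
      have h1 := ih _ _ _ _ h' (h.dart₁ d w)
      rwa [mul_assoc, m₁, ← walkLabel_cons] at h1
  have m₂ : ∀ x y, ((1, x) : (tannerGraph H₁).Pi1 t₁ × (tannerGraph H₂).Pi1 t₂) * (1, y) =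
      (1, x * y) := fun x y => Prod.ext (one_mul 1) rfl
  have h₂ : ∀ v l a b w g, (tannerGraph H₂).IsWalk a b l → ProdReach γ₁ γ₂ R v w a g →
      ProdReach γ₁ γ₂ R v w b (g * (1, walkLabel (TwoComplex.tautLabel γ₂) l)) := by
    intro v l
    induction l with
    | nil =>
      rintro a b w g rfl h
      exact (mul_one g).symm ▸ h
    | cons d l ih =>
      rintro a b w g ⟨rfl, h'⟩ h
      have h1 := ih _ _ _ _ h' (h.dart₂ d w)
      rwa [mul_assoc, m₂, ← walkLabel_cons] at h1
  rintro v a ⟨g₁, g₂⟩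
  obtain ⟨l₁, hl₁, rfl⟩ := TwoComplex.isFull_tautLabel γ₁ (coord v).1 (coord a).1 g₁
  obtain ⟨l₂, hl₂, rfl⟩ := TwoComplex.isFull_tautLabel γ₂ (coord v).2 (coord a).2 g₂
  have h0 : Reach (hpcLabel γ₁ γ₂) R v v 1 := ⟨[], rfl, rfl⟩
  have h1 := prodReach_coord.1 (h₂ _ _ _ _ _ _ hl₂ (h₁ _ _ _ _ _ _ hl₁ (prodReach_coord.2 h0)))
  rwa [one_mul, Prod.mk_mul_mk, mul_one, one_mul] at h1

/-- The tautological label `m` of the realization is recovered, up to the gauge `k`, by applying `Ψ`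
to `hpcLabel`. A loop with trivial `hpcLabel` thus has trivial tautological label and is
null-homotopic. -/
theorem hpc_hom_injective (γ₁ : ∀ a, (tannerGraph H₁).Walk t₁ a)
    (γ₂ : ∀ a, (tannerGraph H₂).Walk t₂ a) (R : Realization (hpcLift H₁ H₂))
    (v : R.complex.V) :
    Function.Injective
      ((isFlat_label (Λ := hpcLabel γ₁ γ₂) (R := R)).hom v) := by
  have hη : ∀ a, Nonempty (R.complex.Walk v a) := fun a => by
    obtain ⟨l, hl, -⟩ := isFull_hpcLabel γ₁ γ₂ R v a 1
    exact ⟨⟨l, hl⟩⟩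
  have η : ∀ a, R.complex.Walk v a := fun a => Classical.choice (hη a)
  let m : R.complex.E → R.complex.Pi1 v := TwoComplex.tautLabel η
  obtain ⟨μ, hμ⟩ := exists_triv (TwoComplex.isFlat_tautLabel η)
  change ∀ z e, m (R.inclE z e) = _ at hμ
  let θ : K₁ × B₂ → B₁ × B₂ ⊕ K₁ × K₂ → R.complex.Pi1 v := fun x q =>
    if h : (hpcLift H₁ H₂).hx x q ≠ 0 then m (Sum.inl (hpcEdge h)) else 1
  have hθ : ∀ t : (hpcLift H₁ H₂).TEdge, m (Sum.inl t) = θ t.1.1 t.1.2 := by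
    intro t
    have h : θ t.1.1 t.1.2 = m (Sum.inl (hpcEdge t.hx_ne_zero)) := dif_pos t.hx_ne_zero
    rw [h, ← hpcEdge_eq]
  have hθμ : ∀ x q z, (hpcLift H₁ H₂).hx x q ≠ 0 → (hpcLift H₁ H₂).hz z q ≠ 0 →
      θ x q = (μ z (Sum.inr q))⁻¹ * μ z (Sum.inl x) := by
    intro x q z hx hz
    exact (hθ (hpcEdge hx)).symm.trans (hμ z (Sum.inl ⟨hpcEdge hx, hz⟩))
  -- The label `m` is carried to the product: `θ` on edges between `X`-checks and qubits, and `μ z`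
  -- on the new edges from `z` to its qubits, inverted when the orientation is opposite.
  obtain ⟨Ψ, h, h1, h2⟩ := TwoComplex.exists_hom_of_squares γ₁ γ₂ (Γ := R.complex.Pi1 v)
    (fun w e => match w with
      | Sum.inl k₂ => μ (e.1.2, k₂) (Sum.inr (Sum.inr (e.1.1, k₂)))
      | Sum.inr b₂ => θ (e.1.1, b₂) (Sum.inl (e.1.2, b₂)))
    (fun w e => match w with
      | Sum.inl k₁ => (θ (k₁, e.1.2) (Sum.inr (k₁, e.1.1)))⁻¹
      | Sum.inr b₁ => (μ (b₁, e.1.1) (Sum.inr (Sum.inl (b₁, e.1.2))))⁻¹)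
    (fun _ f => PEmpty.elim f) (fun _ f => PEmpty.elim f) (by
      rintro ⟨⟨k₁, b₁⟩, h₁⟩ ⟨⟨k₂, b₂⟩, h₂⟩
      change θ (k₁, b₂) (Sum.inl (b₁, b₂)) * (θ (k₁, b₂) (Sum.inr (k₁, k₂)))⁻¹ =
        (μ (b₁, k₂) (Sum.inr (Sum.inl (b₁, b₂))))⁻¹ * μ (b₁, k₂) (Sum.inr (Sum.inr (k₁, k₂)))
      -- The two edges at the corner `x` are differences of values of the same `μ z`, where `z` is
      -- the opposite corner; the value at `x` cancels.
      rw [hθμ (k₁, b₂) (Sum.inl (b₁, b₂)) (b₁, k₂) (hx_inl_ne.2 ⟨rfl, h₁⟩)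
        (hz_inl_ne.2 ⟨rfl, h₂⟩), hθμ (k₁, b₂) (Sum.inr (k₁, k₂)) (b₁, k₂)
        (hx_inr_ne.2 ⟨rfl, h₂⟩) (hz_inr_ne.2 ⟨rfl, h₁⟩)]
      group)
  let k : K₁ × B₂ ⊕ (B₁ × B₂ ⊕ K₁ × K₂) → R.complex.Pi1 v := fun a => h (coord a).1 (coord a).2
  have hT : ∀ x q, (hpcLift H₁ H₂).hx x q ≠ 0 →
      k (Sum.inr q) * θ x q = Ψ ((hpcLabel γ₁ γ₂).edge x q) * k (Sum.inl x) := by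
    rintro ⟨k₁, b₂⟩ (⟨b₁, b₂'⟩ | ⟨k₁', k₂⟩) hx
    · obtain ⟨rfl, h0⟩ := hx_inl_ne.1 hx
      have h3 := h1 ⟨(k₁, b₁), h0⟩ (Sum.inr b₂)
      rw [← entryLabel_eq γ₁ h0] at h3
      exact h3
    · obtain ⟨rfl, h0⟩ := hx_inr_ne.1 hx
      have h3 := h2 (Sum.inl k₁) ⟨(k₂, b₂), h0⟩
      rw [← entryLabel_eq γ₂ h0] at h3
      change h (Sum.inl k₁) (Sum.inr b₂) * (θ (k₁, b₂) (Sum.inr (k₁, k₂)))⁻¹ =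
        Ψ (1, entryLabel γ₂ k₂ b₂) * h (Sum.inl k₁) (Sum.inl k₂) at h3
      change h (Sum.inl k₁) (Sum.inl k₂) * θ (k₁, b₂) (Sum.inr (k₁, k₂)) =
        Ψ (1, (entryLabel γ₂ k₂ b₂)⁻¹) * h (Sum.inl k₁) (Sum.inr b₂)
      have h4 : ((1, (entryLabel γ₂ k₂ b₂)⁻¹) : (tannerGraph H₁).Pi1 t₁ × _) =
          (1, entryLabel γ₂ k₂ b₂)⁻¹ := by rw [Prod.inv_mk, inv_one]
      rw [h4, map_inv, mul_inv_eq_iff_eq_mul.1 h3]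
      group
  have hZQ : ∀ (z : B₁ × K₂) q, (hpcLift H₁ H₂).hz z q ≠ 0 →
      h (Sum.inr z.1) (Sum.inl z.2) * μ z (Sum.inr q) =
        Ψ ((hpcLabel γ₁ γ₂).triv z (Sum.inr q)) * k (Sum.inr q) := by
    rintro ⟨b₁, k₂⟩ (⟨b₁', b₂⟩ | ⟨k₁, k₂'⟩) hz
    · obtain ⟨rfl, h0⟩ := hz_inl_ne.1 hz
      have h3 := h2 (Sum.inr b₁) ⟨(k₂, b₂), h0⟩
      rw [← entryLabel_eq γ₂ h0] at h3
      change h (Sum.inr b₁) (Sum.inr b₂) * (μ (b₁, k₂) (Sum.inr (Sum.inl (b₁, b₂))))⁻¹ =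
        Ψ (1, entryLabel γ₂ k₂ b₂) * h (Sum.inr b₁) (Sum.inl k₂) at h3
      change h (Sum.inr b₁) (Sum.inl k₂) * μ (b₁, k₂) (Sum.inr (Sum.inl (b₁, b₂))) =
        Ψ (1, (entryLabel γ₂ k₂ b₂)⁻¹) * h (Sum.inr b₁) (Sum.inr b₂)
      have h4 : ((1, (entryLabel γ₂ k₂ b₂)⁻¹) : (tannerGraph H₁).Pi1 t₁ × _) =
          (1, entryLabel γ₂ k₂ b₂)⁻¹ := by rw [Prod.inv_mk, inv_one]
      rw [h4, map_inv, mul_inv_eq_iff_eq_mul.1 h3]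
      group
    · obtain ⟨rfl, h0⟩ := hz_inr_ne.1 hz
      have h3 := h1 ⟨(k₁, b₁), h0⟩ (Sum.inl k₂)
      rw [← entryLabel_eq γ₁ h0] at h3
      exact h3
  -- The gauge relation along the virtual edges from `z` to its qubits passes to neighbouring
  -- `X`-checks. It is needed there since 1-cells may end at `X`-checks.
  have hZ : ∀ (z : B₁ × K₂) a, (hpcLift H₁ H₂).InT z a →
      h (Sum.inr z.1) (Sum.inl z.2) * μ z a = Ψ ((hpcLabel γ₁ γ₂).triv z a) * k a := by
    rintro z (x | q) ha
    · obtain ⟨q, hz, hx⟩ := ha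
      have h3 := hZQ z q hz
      have h4 := hT x q hx
      rw [hθμ x q z hx hz, (hpcLabel γ₁ γ₂).edge_eq x q z hx hz, map_mul, map_inv] at h4
      rw [eq_mul_inv_of_mul_eq h3]
      calc _ = Ψ ((hpcLabel γ₁ γ₂).triv z (Sum.inr q)) *
            (k (Sum.inr q) * ((μ z (Sum.inr q))⁻¹ * μ z (Sum.inl x))) := by group
        _ = _ := by rw [h4]; group
    · exact hZQ z q ha
  have hE : ∀ e, k (R.complex.src e) * m e =
      Ψ (R.label (hpcLabel γ₁ γ₂) e) * k (R.complex.tgt e) := by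
    rintro (t | ⟨z, e⟩)
    · rw [hθ]
      exact hT _ _ t.hx_ne_zero
    · have h3 := hZ z _ ((hpcLift H₁ H₂).inT_proj z ((R.handle z).fst e))
      have h4 := hZ z _ ((hpcLift H₁ H₂).inT_proj z ((R.handle z).snd e))
      have h5 := hμ z (Sum.inr e)
      change m (Sum.inr ⟨z, e⟩) = (μ z ((hpcLift H₁ H₂).proj z ((R.handle z).fst e)))⁻¹ *
        μ z ((hpcLift H₁ H₂).proj z ((R.handle z).snd e)) at h5
      change k ((hpcLift H₁ H₂).proj z ((R.handle z).fst e)) * m (Sum.inr ⟨z, e⟩) =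
        Ψ (((hpcLabel γ₁ γ₂).triv z _)⁻¹ * (hpcLabel γ₁ γ₂).triv z _) *
          k ((hpcLift H₁ H₂).proj z ((R.handle z).snd e))
      rw [h5, map_mul, map_inv, mul_assoc, ← h4, ← inv_mul_eq_iff_eq_mul.2 h3]
      group
  have hW : ∀ l a b, R.complex.IsWalk a b l →
      k a * walkLabel m l = Ψ (walkLabel (R.label (hpcLabel γ₁ γ₂)) l) * k b := by
    intro l
    induction l with
    | nil =>
      rintro a b rfl
      rw [walkLabel_nil, walkLabel_nil, map_one, one_mul, mul_one]
    | cons d l ih =>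
      rintro a b ⟨rfl, h3⟩
      have h4 := ih _ _ h3
      rw [walkLabel_cons, walkLabel_cons, map_mul, mul_assoc, ← h4]
      rcases d with ⟨e, _ | _⟩
      · have h5 := hE e
        simp only [dartLabel, MultiGraph.dsrc, MultiGraph.dtgt, Bool.false_eq_true, if_false,
          map_inv]
        rw [← mul_assoc, ← mul_assoc, eq_mul_inv_of_mul_eq h5]
        group
      · have h5 := hE e
        simp only [dartLabel, MultiGraph.dsrc, MultiGraph.dtgt, if_true]
        rw [← mul_assoc, ← mul_assoc, h5]
  refine (injective_iff_map_eq_one _).2 ?_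
  rintro ⟨w⟩ hw
  refine TwoComplex.Pi1.mk_eq.2 (TwoComplex.homotopic_nil_of_walkLabel η w ?_)
  -- On loops at `v` the composite of `Ψ` with the label is conjugation by `k v`.
  have h3 := hW w.1 v v w.2
  have h4 : walkLabel (R.label (hpcLabel γ₁ γ₂)) w.1 = 1 := hw
  rw [h4, map_one, one_mul] at h3
  exact mul_eq_left.1 h3

end HPC

end Realization

/-! ### Existence of realizations and fibers of coverings -/

namespace TwoComplex

/-- Finitely many 2-cells make a finite connected graph simply connected. -/
theorem exists_twoCells (G : MultiGraph.{u}) [Finite G.E] (hG : G.Preconnected) :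
    ∃ (F : Type u) (_ : Finite F) (base : F → G.V) (bdry : F → List G.Dart)
      (h : ∀ f, G.IsWalk (base f) (base f) (bdry f)),
      (TwoComplex.mk G F base bdry h).SimplyConnected := by
  by_cases hV : Nonempty G.V
  · obtain ⟨r⟩ := hV
    choose l hl using hG r
    have hb : ∀ e, G.IsWalk r r (l (G.src e) ++ [(e, true)] ++ G.revWalk (l (G.tgt e))) := by
      intro e
      have h1 : G.IsWalk (G.src e) (G.tgt e) [(e, true)] := ⟨rfl, rfl⟩
      exact ((hl (G.src e)).append h1).append (hl (G.tgt e)).rev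
    -- One 2-cell is attached for every edge, along the loop defining its tautological label; all
    -- tautological labels become trivial.
    refine ⟨G.E, inferInstance, fun _ => r, _, hb, hG, fun a w => ?_⟩
    let L := TwoComplex.mk G G.E (fun _ => r) _ hb
    let η : ∀ a, L.Walk r a := fun a => ⟨l a, hl a⟩
    refine homotopic_nil_of_walkLabel (L := L) η w ?_
    have h1 : ∀ e : L.E, tautLabel η e = 1 := fun e =>
      Pi1.mk_eq.2 (Homotopic.symm (.rel _ _
        (show L.Elem [] (L.bdry e) by simpa using Elem.face (L := L) [] [] e)))
    refine (MultiGraph.IsWalk.label_eq (h := fun _ => 1) (fun e => ?_) w.2).trans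
      (inv_mul_cancel _)
    rw [h1, inv_one, one_mul]
  · exact ⟨PEmpty, inferInstance, fun f => f.elim, fun f => f.elim, fun f => f.elim, hG,
      fun a => (hV ⟨a⟩).elim⟩

theorem cosetCover_fibers {L : TwoComplex.{u}} {Γ : Type u} [Group Γ] {m : L.E → Γ}
    {hm : L.IsFlat m} {hf : L.IsFull m} {v : L.V} {H : Subgroup Γ} {c : L.PointedCover v}
    (h : c.Iso (cosetCover hm hf v H)) [Finite L.V] :
    (Finite c.total.V ↔ H.FiniteIndex) ∧
      ∀ w, Nat.card {w' : c.total.V // c.p.onV w' = w} = H.index := by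
  obtain ⟨f, hb, ho, -⟩ := h
  let e : c.total.V ≃ L.V × (Γ ⧸ H) := Equiv.ofBijective f.onV hb.1
  have he : ∀ w, (e w).1 = c.p.onV w := congrFun ho.1
  constructor
  · rw [e.finite_iff, Subgroup.finiteIndex_iff_finite_quotient]
    have : Nonempty L.V := ⟨v⟩
    exact ⟨fun _ => Finite.prod_right L.V, fun _ => inferInstance⟩
  · intro w
    refine Nat.card_congr ((e.subtypeEquiv (q := fun y => y.1 = w) fun a => by rw [he]).trans ?_)
    exact
      { toFun := fun y => y.1.2
        invFun := fun s => ⟨(w, s), rfl⟩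
        left_inv := fun ⟨y, hy⟩ => Subtype.ext (Prod.ext hy.symm rfl)
        right_inv := fun _ => rfl }

end TwoComplex

/-- The classes of a relation on a finite type can be joined in a tree-like way. -/
theorem exists_joining_edges {α : Type u} [Finite α] (r : α → α → Prop) :
    ∃ (E : Type u) (_ : Finite E) (f s : E → α),
      (∀ a b, Relation.EqvGen (fun a b => r a b ∨ ∃ e, a = f e ∧ b = s e) a b) ∧
      Nat.card E = Nat.card (Quot r) - 1 := by
  classical
  by_cases hα : Nonempty α
  · obtain ⟨a₀⟩ := hα
    let c₀ : Quot r := Quot.mk r a₀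
    -- A star: one edge from `a₀` to a representative of every other class.
    refine ⟨{c : Quot r // c ≠ c₀}, inferInstance, fun _ => a₀, fun c => c.1.out, ?_, ?_⟩
    · have h1 : ∀ a b, Quot.mk r a = Quot.mk r b →
          Relation.EqvGen (fun a b => r a b ∨ ∃ e : {c : Quot r // c ≠ c₀},
            a = a₀ ∧ b = e.1.out) a b :=
        fun a b h => Relation.EqvGen.mono (fun _ _ => Or.inl) _ _ (Quot.eqvGen_exact h)
      have h2 : ∀ a, Relation.EqvGen (fun a b => r a b ∨ ∃ e : {c : Quot r // c ≠ c₀},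
            a = a₀ ∧ b = e.1.out) a₀ a := by
        intro a
        by_cases h : Quot.mk r a = c₀
        · exact h1 _ _ h.symm
        · exact Relation.EqvGen.trans _ _ _
            (Relation.EqvGen.rel _ _ (Or.inr ⟨⟨_, h⟩, rfl, rfl⟩)) (h1 _ _ (Quot.out_eq _))
      exact fun a b => Relation.EqvGen.trans _ _ _ (Relation.EqvGen.symm _ _ (h2 a)) (h2 b)
    · have := Fintype.ofFinite (Quot r)
      rw [Nat.card_eq_fintype_card, Nat.card_eq_fintype_card]
      exact Set.card_ne_eq c₀
  · have : IsEmpty α := not_nonempty_iff.1 hα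
    have : IsEmpty (Quot r) := ⟨fun c => isEmptyElim c.out⟩
    -- Without classes the required number of edges is the truncated difference `0 - 1 = 0`.
    exact ⟨PEmpty, inferInstance, fun e => e.elim, fun e => e.elim, fun a => isEmptyElim a,
      by simp⟩

section Handle

variable {X Q Z : Type u} [Fintype Q] {C : CSSCode X Q Z} {D : ZLift C} {z : Z}

theorem ZLift.HalfEdge.hz_ne_zero (h : D.HalfEdge z) : D.hz z h.1.1 ≠ 0 :=
  fun h1 => Fin.elim0 (Fin.cast (by rw [h1]; rfl) h.1.2)

theorem ZLift.HalfEdge.hx_ne_zero (h : D.HalfEdge z) : D.hx h.2.1 h.1.1 ≠ 0 :=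
  fun h1 => Fin.elim0 (Fin.cast (by rw [h1]; rfl) h.2.2)

theorem ZLift.exists_proj_eq {a : X ⊕ Q} (ha : D.InT z a) : ∃ g, D.proj z g = a := by
  rcases a with x | q
  · obtain ⟨q, hz, hx⟩ := ha
    exact ⟨Sum.inr ⟨⟨q, ⟨0, Int.natAbs_pos.2 hz⟩⟩, x, ⟨0, Int.natAbs_pos.2 hx⟩⟩, rfl⟩
  · exact ⟨Sum.inl ⟨q, ⟨0, Int.natAbs_pos.2 ha⟩⟩, rfl⟩

/-- The connections of `G_z` with its 1-cells project to paths; paired copies of `x` have the same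
image, so passing between them projects to a constant path. -/
theorem HandleFrame.preconnected (A : HandleFrame D z) : A.graph.Preconnected := by
  have h : ∀ a b : D.GVert z, ∃ l, A.graph.IsWalk ⟨D.proj z a, D.inT_proj z a⟩
      ⟨D.proj z b, D.inT_proj z b⟩ l := by
    intro a b
    have := A.joined a b
    induction this with
    | rel a b hab =>
      rcases hab with ⟨h, rfl, rfl⟩ | ⟨h, rfl, rfl⟩ | ⟨e, rfl, rfl⟩
      · exact ⟨[(Sum.inl ⟨⟨(h.2.1, h.1.1), h.2.2⟩, h.hz_ne_zero⟩, true)], rfl, rfl⟩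
      · exact ⟨[], Subtype.ext (congrArg Sum.inl (A.pair_check h).symm)⟩
      · exact ⟨[(Sum.inr e, true)], rfl, rfl⟩
    | refl a => exact ⟨[], rfl⟩
    | symm a b _ ih =>
      obtain ⟨l, hl⟩ := ih
      exact ⟨_, hl.rev⟩
    | trans a b c _ _ ih ih' =>
      obtain ⟨l, hl⟩ := ih
      obtain ⟨l', hl'⟩ := ih'
      exact ⟨_, hl.append hl'⟩
  rintro ⟨a, ha⟩ ⟨b, hb⟩
  obtain ⟨a, rfl⟩ := D.exists_proj_eq ha
  obtain ⟨b, rfl⟩ := D.exists_proj_eq hb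
  exact h a b

/-- Every pairing of the half-edges of opposite signs extends to a dressed handle. -/
theorem nonempty_handle [Finite X] (pair : D.HalfEdge z → D.HalfEdge z)
    (pair_pair : ∀ h, pair (pair h) = h) (pair_check : ∀ h, (pair h).2.1 = h.2.1)
    (pair_sign : ∀ h, D.halfSign z (pair h) = -D.halfSign z h) : Nonempty (Handle D z) := by
  obtain ⟨E, hE, f, s, hj, hc⟩ := exists_joining_edges fun a b : D.GVert z =>
    (∃ h, a = Sum.inl h.1 ∧ b = Sum.inr h) ∨ (∃ h, a = Sum.inr h ∧ b = Sum.inr (pair h))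
  let A : HandleFrame D z :=
    { pair, pair_pair, pair_check, pair_sign
      OneCell := E
      finite_oneCell := hE
      fst := f
      snd := s
      joined := fun a b => Relation.EqvGen.mono (fun _ _ => or_assoc.1) _ _ (hj a b)
      card_oneCell := hc }
  have : Finite A.graph.E := inferInstanceAs (Finite ({e : D.TEdge // D.hz z e.1.2 ≠ 0} ⊕ E))
  obtain ⟨F, hF, base, bdry, hb, hs⟩ := TwoComplex.exists_twoCells A.graph A.preconnected
  exact ⟨⟨A, F, hF, base, bdry, hb, hs⟩⟩

end Handle

section HPC

variable {K₁ B₁ K₂ B₂ : Type u} [Fintype K₁] [Fintype B₁] [Fintype K₂] [Fintype B₂]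
  [DecidableEq K₁] [DecidableEq B₁] [DecidableEq K₂] [DecidableEq B₂]
  {H₁ : Matrix K₁ B₁ (ZMod 2)} {H₂ : Matrix K₂ B₂ (ZMod 2)}

namespace Realization

theorem hpc_halfSign {z : B₁ × K₂} (h : (hpcLift H₁ H₂).HalfEdge z) :
    (hpcLift H₁ H₂).halfSign z h = Sum.elim (fun _ => 1) (fun _ => -1) h.1.1 := by
  rw [ZLift.halfSign, hpc_hx_eq_one h.hx_ne_zero, hpc_hz_eq h.hz_ne_zero]
  rcases h.1.1 with _ | _ <;> rfl

theorem hpc_halfEdge_ext {z : B₁ × K₂} {h h' : (hpcLift H₁ H₂).HalfEdge z}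
    (hq : h.1.1 = h'.1.1) (hx : h.2.1 = h'.2.1) : h = h' := by
  have hx1 := hpc_hx_eq_one h.hx_ne_zero
  have hz1 : ((hpcLift H₁ H₂).hz z h.1.1).natAbs = 1 := by
    rw [hpc_hz_eq h.hz_ne_zero]
    rcases h.1.1 with _ | _ <;> rfl
  obtain ⟨⟨q, i⟩, x, j⟩ := h
  obtain ⟨⟨q', i'⟩, x', j'⟩ := h'
  obtain rfl : q = q' := hq
  obtain rfl : x = x' := hx
  dsimp only at i j i' j' hx1 hz1
  obtain rfl : i = i' := Fin.ext (by omega)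
  obtain rfl : j = j' := Fin.ext (by omega)
  rfl

/-- For `z = (b₁, k₂)` and `x = (k₁, b₂)` the only possible half-edges at `x` come from the qubits
`(b₁, b₂)`, of sign `1`, and `(k₁, k₂)`, of sign `-1`. Each is present exactly when both entries `H₁
k₁ b₁` and `H₂ k₂ b₂` are nonzero, so they occur together and the pairing is forced. -/
theorem existsUnique_hpc_pair {z : B₁ × K₂} (h : (hpcLift H₁ H₂).HalfEdge z) :
    ∃! h' : (hpcLift H₁ H₂).HalfEdge z, h'.2.1 = h.2.1 ∧
      (hpcLift H₁ H₂).halfSign z h' = -(hpcLift H₁ H₂).halfSign z h := by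
  obtain ⟨b₁, k₂⟩ := z
  have hx := h.hx_ne_zero
  have hz := h.hz_ne_zero
  have ex : ∃ h' : (hpcLift H₁ H₂).HalfEdge (b₁, k₂), h'.2.1 = h.2.1 ∧
      (hpcLift H₁ H₂).halfSign _ h' = -(hpcLift H₁ H₂).halfSign _ h := by
    rw [hpc_halfSign h]
    obtain ⟨⟨⟨b₁', b₂'⟩ | ⟨k₁', k₂'⟩, i⟩, ⟨k₁, b₂⟩, j⟩ := h
    · obtain ⟨rfl, h1⟩ := hz_inl_ne.1 hz
      obtain ⟨rfl, h2⟩ := hx_inl_ne.1 hx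
      have hz' := hz_inr_ne (H₁ := H₁) (H₂ := H₂) (k₂ := k₂) |>.2 ⟨rfl, h2⟩
      have hx' := hx_inr_ne (H₁ := H₁) (H₂ := H₂) (k₁ := k₁) |>.2 ⟨rfl, h1⟩
      exact ⟨⟨⟨_, ⟨0, Int.natAbs_pos.2 hz'⟩⟩, _, ⟨0, Int.natAbs_pos.2 hx'⟩⟩, rfl,
        hpc_halfSign _⟩
    · obtain ⟨rfl, h1⟩ := hz_inr_ne.1 hz
      obtain ⟨rfl, h2⟩ := hx_inr_ne.1 hx
      have hz' := hz_inl_ne (H₁ := H₁) (H₂ := H₂) (b₁ := b₁) |>.2 ⟨rfl, h2⟩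
      have hx' := hx_inl_ne (H₁ := H₁) (H₂ := H₂) (b₂ := b₂) |>.2 ⟨rfl, h1⟩
      exact ⟨⟨⟨_, ⟨0, Int.natAbs_pos.2 hz'⟩⟩, _, ⟨0, Int.natAbs_pos.2 hx'⟩⟩, rfl,
        (hpc_halfSign _).trans (neg_neg _).symm⟩
  refine existsUnique_of_exists_of_unique ex ?_
  rintro h₁ h₂ ⟨hc₁, hs₁⟩ ⟨hc₂, hs₂⟩
  have hs := hs₁.trans hs₂.symm
  have hc := hc₁.trans hc₂.symm
  refine hpc_halfEdge_ext ?_ hc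
  rw [hpc_halfSign, hpc_halfSign] at hs
  have hx₁ := h₁.hx_ne_zero
  have hx₂ := h₂.hx_ne_zero
  have hz₁ := h₁.hz_ne_zero
  have hz₂ := h₂.hz_ne_zero
  rw [hc] at hx₁
  generalize h₂.2.1 = x at hx₁ hx₂
  generalize h₁.1.1 = q₁ at hs hz₁ hx₁ ⊢
  generalize h₂.1.1 = q₂ at hs hz₂ hx₂ ⊢
  obtain ⟨k₁, b₂⟩ := x
  rcases q₁ with ⟨b, b'⟩ | ⟨k, k'⟩ <;> rcases q₂ with ⟨c, c'⟩ | ⟨l, l'⟩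
  · rw [← (hz_inl_ne.1 hz₁).1, ← (hz_inl_ne.1 hz₂).1, ← (hx_inl_ne.1 hx₁).1,
      ← (hx_inl_ne.1 hx₂).1]
  · exact absurd hs (show ¬(1 : ℤ) = -1 by decide)
  · exact absurd hs (show ¬(-1 : ℤ) = 1 by decide)
  · rw [← (hz_inr_ne.1 hz₁).1, ← (hz_inr_ne.1 hz₂).1, ← (hx_inr_ne.1 hx₁).1,
      ← (hx_inr_ne.1 hx₂).1]

theorem nonempty_hpc : Nonempty (Realization (hpcLift H₁ H₂)) := by
  have h : ∀ z, Nonempty (Handle (hpcLift H₁ H₂) z) := by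
    intro z
    choose pair hpair huniq using fun h => existsUnique_hpc_pair (H₁ := H₁) (H₂ := H₂) (z := z) h
    refine nonempty_handle pair (fun h => ?_) (fun h => (hpair h).1) fun h => (hpair h).2
    exact (huniq (pair h) h ⟨(hpair h).1.symm, by rw [(hpair h).2, neg_neg]⟩).symm
  exact ⟨⟨fun z => Classical.choice (h z)⟩⟩

/-- A path between a bit and a check is nonempty, and its first edge is a nonzero entry at the
starting vertex. -/
theorem exists_entry_of_isWalk {K B : Type u} {H : Matrix K B (ZMod 2)} {k : K} {b : B}
    {l : List (tannerGraph H).Dart} :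
    ((tannerGraph H).IsWalk (Sum.inr b) (Sum.inl k) l → ∃ k, H k b ≠ 0) ∧
      ((tannerGraph H).IsWalk (Sum.inl k) (Sum.inr b) l → ∃ b, H k b ≠ 0) := by
  constructor <;> intro h <;> rcases l with _ | ⟨⟨e, _ | _⟩, l⟩
  · exact absurd h Sum.inr_ne_inl
  · exact absurd h.1 Sum.inl_ne_inr
  · obtain rfl : e.1.2 = b := Sum.inr.inj h.1
    exact ⟨_, e.2⟩
  · exact absurd h Sum.inl_ne_inr
  · obtain rfl : e.1.1 = k := Sum.inl.inj h.1
    exact ⟨_, e.2⟩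
  · exact absurd h.1 Sum.inr_ne_inl

/-- A vertex `v` is needed: it makes `K₁` or `B₂` nonempty, and connectedness then gives `z` a
qubit. If both were empty, a `Z`-check would have empty support. -/
theorem hpc_exists_inT (hT₁ : (tannerGraph H₁).Connected) (hT₂ : (tannerGraph H₂).Connected)
    (v : K₁ × B₂ ⊕ (B₁ × B₂ ⊕ K₁ × K₂)) (z : B₁ × K₂) : ∃ a, (hpcLift H₁ H₂).InT z a := by
  obtain ⟨b₁, k₂⟩ := z
  have hK : K₁ → ∃ a, (hpcLift H₁ H₂).InT (b₁, k₂) a := by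
    intro k
    obtain ⟨l, hl⟩ := hT₁.2 (Sum.inr b₁) (Sum.inl k)
    obtain ⟨k₁, h⟩ := exists_entry_of_isWalk.1 hl
    exact ⟨Sum.inr (Sum.inr (k₁, k₂)), hz_inr_ne.2 ⟨rfl, h⟩⟩
  have hB : B₂ → ∃ a, (hpcLift H₁ H₂).InT (b₁, k₂) a := by
    intro b
    obtain ⟨l, hl⟩ := hT₂.2 (Sum.inl k₂) (Sum.inr b)
    obtain ⟨b₂, h⟩ := exists_entry_of_isWalk.2 hl
    exact ⟨Sum.inr (Sum.inl (b₁, b₂)), hz_inl_ne.2 ⟨rfl, h⟩⟩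
  rcases v with x | q | q
  · exact hK x.1
  · exact hB q.2
  · exact hK q.1

end Realization

end HPC

/-! ### Classification of the cellular lifts -/

open Realization in
theorem mainTheorem1 {K₁ B₁ K₂ B₂ : Type u} [Fintype K₁] [Fintype B₁] [Fintype K₂] [Fintype B₂]
    [DecidableEq K₁] [DecidableEq B₁] [DecidableEq K₂] [DecidableEq B₂]
    (H₁ : Matrix K₁ B₁ (ZMod 2)) (H₂ : Matrix K₂ B₂ (ZMod 2))
    (hT₁ : (tannerGraph H₁).Connected) (hT₂ : (tannerGraph H₂).Connected)
    (t₁ : (tannerGraph H₁).V) (t₂ : (tannerGraph H₂).V) :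
    Nonempty (Realization (hpcLift H₁ H₂)) ∧
    ∃ Φ : ∀ (R : Realization (hpcLift H₁ H₂)) (v : R.complex.V),
        R.complex.Pi1 v ≃* (tannerGraph H₁).Pi1 t₁ × (tannerGraph H₂).Pi1 t₂,
      (∀ (R : Realization (hpcLift H₁ H₂)) (v : R.complex.V)
        (H : Subgroup ((tannerGraph H₁).Pi1 t₁ × (tannerGraph H₂).Pi1 t₂)),
        ∃ c : R.complex.PointedCover v, c.subgroup.map (Φ R v).toMonoidHom = H) ∧
      (∀ (R : Realization (hpcLift H₁ H₂)) (v : R.complex.V) (c c' : R.complex.PointedCover v),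
        c.Iso c' ↔
          c.subgroup.map (Φ R v).toMonoidHom = c'.subgroup.map (Φ R v).toMonoidHom) ∧
      (∀ (R : Realization (hpcLift H₁ H₂)) (v : R.complex.V) (c : R.complex.PointedCover v),
        (Finite c.total.V ↔ (c.subgroup.map (Φ R v).toMonoidHom).FiniteIndex) ∧
        ∀ w : R.complex.V, Nat.card {w' : c.total.V // c.p.onV w' = w} =
          (c.subgroup.map (Φ R v).toMonoidHom).index) ∧
      (∀ (R : Realization (hpcLift H₁ H₂)) (v : R.complex.V) (c : R.complex.PointedCover v)
        [Fintype (Realization.QCell c)],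
        Realization.codeX c * (Realization.codeZ c)ᵀ = 0) ∧
      (∀ (R R' : Realization (hpcLift H₁ H₂)) (v : K₁ × B₂ ⊕ (B₁ × B₂ ⊕ K₁ × K₂))
        (c : R.complex.PointedCover v) (c' : R'.complex.PointedCover v),
        Realization.SameLift c c' ↔
          c.subgroup.map (Φ R v).toMonoidHom = c'.subgroup.map (Φ R' v).toMonoidHom) := by
  refine ⟨nonempty_hpc, ?_⟩
  have γ₁ : ∀ a, (tannerGraph H₁).Walk t₁ a := fun a => ⟨_, (hT₁.2 t₁ a).choose_spec⟩
  have γ₂ : ∀ a, (tannerGraph H₂).Walk t₂ a := fun a => ⟨_, (hT₂.2 t₂ a).choose_spec⟩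
  have full := isFull_hpcLabel γ₁ γ₂
  have hsurj : ∀ (R : Realization (hpcLift H₁ H₂)) (v : R.complex.V), Function.Surjective
      ((isFlat_label (Λ := hpcLabel γ₁ γ₂) (R := R)).hom v) := by
    intro R v g
    obtain ⟨l, hl, h⟩ := full R v v g
    exact ⟨TwoComplex.Pi1.mk ⟨l, hl⟩, h⟩
  let Φ : ∀ (R : Realization (hpcLift H₁ H₂)) (v : R.complex.V),
      R.complex.Pi1 v ≃* (tannerGraph H₁).Pi1 t₁ × (tannerGraph H₂).Pi1 t₂ := fun R v =>
    MulEquiv.ofBijective _ ⟨hpc_hom_injective γ₁ γ₂ R v, hsurj R v⟩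
  have hmap : ∀ R v H, (cover (full R) v H).subgroup.map (Φ R v).toMonoidHom = H := fun R v H =>
    TwoComplex.map_subgroup_cosetCover isFlat_label (full R) v H _ fun _ => rfl
  have hiso : ∀ (R : Realization (hpcLift H₁ H₂)) (v : R.complex.V)
      (c c' : R.complex.PointedCover v), c.Iso c' ↔
        c.subgroup.map (Φ R v).toMonoidHom = c'.subgroup.map (Φ R v).toMonoidHom :=
    fun R v c c' => (c.iso_iff c').trans
      (Subgroup.map_injective (f := (Φ R v).toMonoidHom) (Φ R v).injective).eq_iff.symm
  -- Each covering is replaced by the coset covering of its own subgroup, on which the remaining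
  -- claims are checked.
  have hcover : ∀ (R : Realization (hpcLift H₁ H₂)) (v : R.complex.V)
      (c : R.complex.PointedCover v),
      c.Iso (cover (full R) v (c.subgroup.map (Φ R v).toMonoidHom)) :=
    fun R v c => (hiso R v _ _).2 (hmap R v _).symm
  refine ⟨Φ, fun R v H => ⟨_, hmap R v H⟩, hiso,
    fun R v c => TwoComplex.cosetCover_fibers (hcover R v c), fun R v c _ =>
      (sameLift_of_iso (hcover R v c)).orth (cover_orth _ _ _), fun R R' v c c' => ?_⟩
  have h1 := sameLift_of_iso (hcover R v c)
  have h2 := sameLift_of_iso (hcover R' v c')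
  have hx2 : ∀ x q, (hpcLift H₁ H₂).hx x q ≠ 0 → (((hpcLift H₁ H₂).hx x q : ℤ) : ZMod 2) ≠ 0 := by
    intro x q h
    rw [hpc_hx_eq_one h]
    decide
  have hz2 : ∀ z q, (hpcLift H₁ H₂).hz z q ≠ 0 → (((hpcLift H₁ H₂).hz z q : ℤ) : ZMod 2) ≠ 0 := by
    intro z q h
    rw [hpc_hz_eq h]
    rcases q with q | q <;> simp
  constructor
  · intro h
    have h3 := (h1.symm.trans h).trans h2
    -- Agreement of lifts is symmetric, so the one-sided inclusion gives equality.
    exact le_antisymm (h3.le hx2 hz2) (h3.symm.le hx2 hz2)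
  · intro h
    rw [h] at h1
    exact (h1.trans (sameLift_cover (hpc_exists_inT hT₁ hT₂ v) _ _ v _)).trans h2.symm
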